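/- Let $N\ge 1$ and $0\le N_1\le N$ be integers and let $p_1,\dots,p_N$ be real numbers with $p_i=1$ for $i\le N_1$ and $p_i>1$ for $i>N_1$. Assume $N_1+\sum_{i>N_1}\frac1{p_i}>1$, put $$p^*=\frac{N}{N_1+\sum_{i>N_1}\frac1{p_i}-1},$$ and assume $\max_i p_i<p^*$. Write $q'=q/(q-1)$ for $q>1$, $\mathcal D(\mathbb R^N)$ for the smooth compactly supported functions, and $\nabla_1=(\partial_1,\dots,\partial_{N_1})$. A Radon measure on $\mathbb R^N$ is an element of the dual of $\mathcal C_c(\mathbb R^N)$; if $\mu=(\mu_1,\dots,\mu_n)$ is a vector of Radon measures, $|\mu|$ is the positive measure given, for $\varphi\ge0$ in $\mathcal C_c(\mathbb R^N)$, by $$\langle|\mu|,\varphi\rangle=\sup\Big\{\sum_i\langle\mu_i,\psi_i\rangle:\ \psi_i\in\mathcal C_c(\mathbb R^N),\ \sum_i\psi_i^2\le\varphi^2\Big\}.$$ Let $BV^{\vec p}(\mathbb R^N)$ be the set of $u\in L^{p^*}(\mathbb R^N)$ whose distributional derivatives satisfy: $\partial_iu$ is a bounded Radon measure for $i\le N_1$,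 and $\partial_iu\in L^{p_i}(\mathbb R^N)$ for $i>N_1$. Let $BV^{\vec p}_{loc}(\mathbb R^N)$ be the set of $u$ such that $\varphi u\in BV^{\vec p}(\mathbb R^N)$ for every $\varphi\in\mathcal D(\mathbb R^N)$. **Theorem.** Let $\sigma:\mathbb R^N\to\mathbb R^N$ be such that its projection $\sigma^1$ on the first $N_1$ coordinates is in $L^\infty_{loc}(\mathbb R^N,\mathbb R^{N_1})$, $\sigma_i\in L^{p_i'}_{loc}(\mathbb R^N)$ for $i>N_1$, and the distributional divergence $\operatorname{div}\sigma$ is in $L^{p^*/(p^*-1)}_{loc}(\mathbb R^N)$. Let $u\in BV^{\vec p}_{loc}(\mathbb R^N)$. Then: 1. For every $\varphi\in\mathcal D(\mathbb R^N)$ the functions $(\operatorname{div}\sigma)\,u\varphi$ and $(\sigma\cdot\nabla\varphi)\,u$ are integrable, and $$\langle\sigma\cdot\nabla u,\varphi\rangle=-\int_{\mathbb R^N}(\operatorname{div}\sigma)\,u\varphi-\int_{\mathbb R^N}(\sigma\cdot\nabla\varphi)\,u$$ defines a distribution $\sigma\cdot\nabla u$, which is a Radon measure. 2. $\nabla_1u$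 is a vector of $N_1$ Radon measures, and for $i>N_1$ one has $\partial_iu\in L^{p_i}_{loc}(\mathbb R^N)$ and $\sigma_i\partial_iu\in L^1_{loc}(\mathbb R^N)$. The Radon measure $$\sigma^1\cdot\nabla_1u:=\sigma\cdot\nabla u-\sum_{i>N_1}\sigma_i\,\partial_iu$$ is absolutely continuous with respect to $|\nabla_1u|$, and for every $\varphi\ge0$ in $\mathcal C_c(\mathbb R^N)$ $$\langle|\sigma^1\cdot\nabla_1u|,\varphi\rangle\le\|\sigma^1\|_{L^\infty(\operatorname{supp}\varphi)}\,\langle|\nabla_1u|,\varphi\rangle .$$ 3. If moreover $\sigma^1\in L^\infty(\mathbb R^N,\mathbb R^{N_1})$, $\sigma_i\in L^{p_i'}(\mathbb R^N)$ for $i>N_1$, $\operatorname{div}\sigma\in L^{p^*/(p^*-1)}(\mathbb R^N)$ and $u\in BV^{\vec p}(\mathbb R^N)$, then $\sigma\cdot\nabla u$ and $\sigma^1\cdot\nabla_1u$ are bounded measures, $(\operatorname{div}\sigma)\,u$ is integrable, $$\int_{\mathbb R^N}\sigma\cdot\nabla u=-\int_{\mathbb R^N}(\operatorname{div}\sigma)\,u\qquad\text{and}\qquad|\sigma^1\cdot\nabla_1u|\le\|\sigma^1\|_{L^\infty(\mathbb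 R^N)}\,|\nabla_1u|\quad\text{as measures.}$$ -/

import Mathlib

open MeasureTheory Set TopologicalSpace
open scoped ENNReal NNReal CompactlySupported Distributions

namespace AnisoBV

noncomputable section

/-! ### Scalar and vector Radon measures as elements of the dual of `C_c` -/

/-- A (signed, not necessarily bounded) scalar Radon measure on `X`, i.e. an element of the dual of
`C_c(X)`: a linear form which, on each compact set `K`, is bounded on the functions supported
in `K` and bounded by `1` (equivalently `|L φ| ≤ C_K sup |φ|` whenever `supp φ ⊆ K`). -/
structure RadonMeasure (X : Type*) [TopologicalSpace X] where
  toLin : C_c(X, ℝ) →ₗ[ℝ] ℝ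
  bound : ∀ K : Set X, IsCompact K → ∃ C : ℝ, ∀ φ : C_c(X, ℝ),
    tsupport φ ⊆ K → (∀ x, |φ x| ≤ 1) → |toLin φ| ≤ C

section TotalVariation

variable {X : Type*} [TopologicalSpace X] {ι : Type*} [Fintype ι]

/-- The numbers `∑ i, ⟨μ i, ψ i⟩`, with `ψ i ∈ C_c(X)` and `∑ i, (ψ i)² ≤ φ²`. -/
def tvSet (μ : ι → RadonMeasure X) (φ : C_c(X, ℝ≥0)) : Set ℝ :=
  {r | ∃ ψ : ι → C_c(X, ℝ), (∀ x, ∑ i, ψ i x ^ 2 ≤ (φ x : ℝ) ^ 2) ∧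
    r = ∑ i, (μ i).toLin (ψ i)}

/-- `⟨|μ|, φ⟩ = sup {∑ i, ⟨μ i, ψ i⟩ : ψ i ∈ C_c(X), ∑ i, (ψ i)² ≤ φ²}` for `φ ≥ 0`. -/
def tvSup (μ : ι → RadonMeasure X) (φ : C_c(X, ℝ≥0)) : ℝ := sSup (tvSet μ φ)

theorem zero_mem_tvSet (μ : ι → RadonMeasure X) (φ : C_c(X, ℝ≥0)) : (0 : ℝ) ∈ tvSet μ φ :=
  ⟨fun _ => 0, fun x => by simp, by simp⟩

theorem bddAbove_tvSet (μ : ι → RadonMeasure X) (φ : C_c(X, ℝ≥0)) : BddAbove (tvSet μ φ) := by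
  obtain ⟨B, hB⟩ : ∃ B : ℝ, ∀ x, ‖(φ x : ℝ)‖ ≤ B := by
    have h1 : Continuous fun x => (φ x : ℝ) := by fun_prop
    have h2 : HasCompactSupport fun x => (φ x : ℝ) :=
      φ.hasCompactSupport.comp_left (g := fun t : ℝ≥0 => (t : ℝ)) NNReal.coe_zero
    exact h1.bounded_above_of_compact_support h2
  have hB' : ∀ x, (φ x : ℝ) ≤ |B| + 1 := fun x => by
    have h1 := (le_abs_self _).trans (hB x)
    have h2 := le_abs_self B
    linarith
  have hpos : 0 < |B| + 1 := by positivity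
  have hK : IsCompact (tsupport φ) := φ.hasCompactSupport
  choose C hC using fun i => (μ i).bound (tsupport φ) hK
  refine ⟨∑ i, (|B| + 1) * C i, ?_⟩
  rintro r ⟨ψ, hψ, rfl⟩
  refine Finset.sum_le_sum fun i _ => ?_
  have hle : ∀ x, |ψ i x| ≤ φ x := fun x => by
    refine abs_le_of_sq_le_sq ?_ (φ x).coe_nonneg
    exact (Finset.single_le_sum (f := fun i => ψ i x ^ 2) (fun j _ => sq_nonneg _)
      (Finset.mem_univ i)).trans (hψ x)
  have key := hC i ((|B| + 1)⁻¹ • ψ i) ?_ ?_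
  · rw [map_smul, smul_eq_mul, abs_mul, abs_of_pos (inv_pos.2 hpos),
      inv_mul_le_iff₀ hpos] at key
    exact (le_abs_self _).trans key
  · refine closure_mono fun x hx => ?_
    rw [Function.mem_support] at hx ⊢
    intro h0
    apply hx
    have := hle x
    rw [h0, NNReal.coe_zero] at this
    have h1 : ψ i x = 0 := abs_nonpos_iff.1 this
    simp [h1]
  · intro x
    rw [CompactlySupportedContinuousMap.smul_apply, smul_eq_mul, abs_mul,
      abs_of_pos (inv_pos.2 hpos), inv_mul_le_iff₀ hpos, mul_one]
    exact (hle x).trans (hB' x)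

theorem tvSup_nonneg (μ : ι → RadonMeasure X) (φ : C_c(X, ℝ≥0)) : 0 ≤ tvSup μ φ :=
  le_csSup (bddAbove_tvSet μ φ) (zero_mem_tvSet μ φ)

theorem smul_mem_tvSet (μ : ι → RadonMeasure X) (φ : C_c(X, ℝ≥0)) (c : ℝ≥0) {r : ℝ}
    (hr : r ∈ tvSet μ φ) : (c : ℝ) * r ∈ tvSet μ (c • φ) := by
  obtain ⟨ψ, hψ, rfl⟩ := hr
  refine ⟨fun i => (c : ℝ) • ψ i, fun x => ?_, ?_⟩
  · have := mul_le_mul_of_nonneg_left (hψ x) (sq_nonneg (c : ℝ))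
    simpa [mul_pow, Finset.mul_sum] using this
  · simp [Finset.mul_sum]

theorem tvSup_smul (μ : ι → RadonMeasure X) (c : ℝ≥0) (φ : C_c(X, ℝ≥0)) :
    tvSup μ (c • φ) = c * tvSup μ φ := by
  have hle : ∀ (c : ℝ≥0) (φ : C_c(X, ℝ≥0)), 0 < c → c * tvSup μ φ ≤ tvSup μ (c • φ) := by
    intro c φ hc
    have hc' : (0 : ℝ) < c := by exact_mod_cast hc
    rw [← le_div_iff₀' hc']
    refine csSup_le ⟨0, zero_mem_tvSet μ φ⟩ fun r hr => ?_
    rw [le_div_iff₀' hc']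
    exact le_csSup (bddAbove_tvSet _ _) (smul_mem_tvSet μ φ c hr)
  rcases eq_or_lt_of_le (zero_le (a := c)) with rfl | hc
  · simp only [zero_smul, NNReal.coe_zero, zero_mul]
    refine le_antisymm (csSup_le ⟨0, zero_mem_tvSet μ _⟩ ?_) (tvSup_nonneg _ _)
    rintro r ⟨ψ, hψ, rfl⟩
    refine le_of_eq (Finset.sum_eq_zero fun i _ => ?_)
    have : ψ i = 0 := by
      ext x
      have h1 := (Finset.single_le_sum (f := fun i => ψ i x ^ 2) (fun j _ => sq_nonneg _)
        (Finset.mem_univ i)).trans (hψ x)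
      simp only [CompactlySupportedContinuousMap.zero_apply, NNReal.coe_zero] at h1 ⊢
      nlinarith [sq_nonneg (ψ i x)]
    rw [this, map_zero]
  · refine le_antisymm ?_ (hle c φ hc)
    have hc' : (0 : ℝ) < c := by exact_mod_cast hc
    have h := hle c⁻¹ (c • φ) (inv_pos.2 hc)
    rw [smul_smul, inv_mul_cancel₀ hc.ne', one_smul, NNReal.coe_inv, inv_mul_le_iff₀ hc'] at h
    exact h

theorem add_mem_tvSet (μ : ι → RadonMeasure X) (φ₁ φ₂ : C_c(X, ℝ≥0)) {r₁ r₂ : ℝ}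
    (h₁ : r₁ ∈ tvSet μ φ₁) (h₂ : r₂ ∈ tvSet μ φ₂) : r₁ + r₂ ∈ tvSet μ (φ₁ + φ₂) := by
  obtain ⟨ψ, hψ, rfl⟩ := h₁
  obtain ⟨χ, hχ, rfl⟩ := h₂
  refine ⟨fun i => ψ i + χ i, fun x => ?_, by simp [Finset.sum_add_distrib]⟩
  have hcs : (∑ i, ψ i x * χ i x) ≤ φ₁ x * φ₂ x := by
    refine le_of_abs_le (abs_le_of_sq_le_sq ?_ (by positivity))
    calc (∑ i, ψ i x * χ i x) ^ 2 ≤ (∑ i, ψ i x ^ 2) * ∑ i, χ i x ^ 2 :=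
          Finset.sum_mul_sq_le_sq_mul_sq _ _ _
      _ ≤ (φ₁ x : ℝ) ^ 2 * (φ₂ x : ℝ) ^ 2 :=
          mul_le_mul (hψ x) (hχ x) (Finset.sum_nonneg fun _ _ => sq_nonneg _) (sq_nonneg _)
      _ = (φ₁ x * φ₂ x : ℝ) ^ 2 := by ring
  have hexp : ∑ i, (ψ i + χ i) x ^ 2
      = ∑ i, ψ i x ^ 2 + 2 * ∑ i, ψ i x * χ i x + ∑ i, χ i x ^ 2 := by
    rw [Finset.mul_sum, ← Finset.sum_add_distrib, ← Finset.sum_add_distrib]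
    refine Finset.sum_congr rfl fun i _ => ?_
    rw [CompactlySupportedContinuousMap.add_apply]
    ring
  rw [hexp, CompactlySupportedContinuousMap.add_apply, NNReal.coe_add]
  nlinarith [hψ x, hχ x]

/-- A component of `ψ` is split in proportion to the two parts of `φ₁ + φ₂`. -/
theorem exists_split (φ₁ φ₂ : C_c(X, ℝ≥0)) (ψ : ι → C_c(X, ℝ))
    (hψ : ∀ x, ∑ i, ψ i x ^ 2 ≤ ((φ₁ + φ₂) x : ℝ) ^ 2) :
    ∃ χ : ι → C_c(X, ℝ), ∀ i x, χ i x = (φ₁ x : ℝ) / (φ₁ x + φ₂ x) * ψ i x := by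
  have hle : ∀ i x, |ψ i x| ≤ φ₁ x + φ₂ x := fun i x => by
    refine abs_le_of_sq_le_sq ?_ (by positivity)
    exact (Finset.single_le_sum (f := fun i => ψ i x ^ 2) (fun j _ => sq_nonneg _)
      (Finset.mem_univ i)).trans (by simpa using hψ x)
  have hcont : ∀ i, Continuous fun x => (φ₁ x : ℝ) / (φ₁ x + φ₂ x) * ψ i x := by
    intro i
    rw [continuous_iff_continuousAt]
    intro x
    by_cases hx : (φ₁ x : ℝ) + φ₂ x = 0
    · have h0 : ψ i x = 0 := abs_nonpos_iff.1 (hx ▸ hle i x)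
      have : Filter.Tendsto (fun y => |ψ i y|) (nhds x) (nhds 0) := by
        have h1 : Continuous fun y => |ψ i y| := (ψ i).continuous.abs
        have h2 := h1.tendsto x
        simpa only [h0, abs_zero] using h2
      unfold ContinuousAt
      simp only [h0, mul_zero]
      refine squeeze_zero_norm (fun y => ?_) this
      rw [norm_mul, Real.norm_eq_abs, Real.norm_eq_abs]
      refine mul_le_of_le_one_left (abs_nonneg _) ?_
      rw [abs_of_nonneg (by positivity)]
      refine div_le_one_of_le₀ ?_ (by positivity)
      linarith [(φ₂ y).coe_nonneg]
    · have c1 : Continuous fun x => (φ₁ x : ℝ) := by fun_prop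
      have c2 : Continuous fun x => (φ₂ x : ℝ) := by fun_prop
      exact (c1.continuousAt.div (c1.add c2).continuousAt hx).mul (ψ i).continuous.continuousAt
  refine ⟨fun i => ⟨⟨_, hcont i⟩, (ψ i).hasCompactSupport.mul_left⟩, fun i x => rfl⟩

theorem tvSup_add (μ : ι → RadonMeasure X) (φ₁ φ₂ : C_c(X, ℝ≥0)) :
    tvSup μ (φ₁ + φ₂) = tvSup μ φ₁ + tvSup μ φ₂ := by
  refine le_antisymm ?_ ?_
  · refine csSup_le ⟨0, zero_mem_tvSet μ _⟩ ?_
    rintro r ⟨ψ, hψ, rfl⟩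
    obtain ⟨χ, hχ⟩ := exists_split φ₁ φ₂ ψ hψ
    have hle : ∀ x, ∑ i, ψ i x ^ 2 ≤ ((φ₁ x : ℝ) + φ₂ x) ^ 2 := fun x => by simpa using hψ x
    have h1 : ∑ i, (μ i).toLin (χ i) ∈ tvSet μ φ₁ := by
      refine ⟨χ, fun x => ?_, rfl⟩
      simp only [hχ, mul_pow, ← Finset.mul_sum]
      by_cases hx : (φ₁ x : ℝ) + φ₂ x = 0
      · rw [hx]; simp
      · calc _ ≤ ((φ₁ x : ℝ) / (φ₁ x + φ₂ x)) ^ 2 * ((φ₁ x : ℝ) + φ₂ x) ^ 2 :=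
              mul_le_mul_of_nonneg_left (hle x) (sq_nonneg _)
          _ = (φ₁ x : ℝ) ^ 2 := by rw [← mul_pow, div_mul_cancel₀ _ hx]
    have h2 : ∑ i, (μ i).toLin (ψ i - χ i) ∈ tvSet μ φ₂ := by
      refine ⟨fun i => ψ i - χ i, fun x => ?_, rfl⟩
      by_cases hx : (φ₁ x : ℝ) + φ₂ x = 0
      · have h0 : ∀ i, ψ i x = 0 := fun i => by
          have h3 := (Finset.single_le_sum (f := fun i => ψ i x ^ 2) (fun j _ => sq_nonneg _)
            (Finset.mem_univ i)).trans (hle x)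
          rw [hx] at h3
          nlinarith [sq_nonneg (ψ i x)]
        simp [hχ, h0]
      · have h3 : ∀ i, (ψ i - χ i) x = (φ₂ x : ℝ) / (φ₁ x + φ₂ x) * ψ i x := fun i => by
          rw [CompactlySupportedContinuousMap.sub_apply, hχ]
          field_simp
          ring
        simp only [h3, mul_pow, ← Finset.mul_sum]
        calc _ ≤ ((φ₂ x : ℝ) / (φ₁ x + φ₂ x)) ^ 2 * ((φ₁ x : ℝ) + φ₂ x) ^ 2 :=
              mul_le_mul_of_nonneg_left (hle x) (sq_nonneg _)
          _ = (φ₂ x : ℝ) ^ 2 := by rw [← mul_pow, div_mul_cancel₀ _ hx]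
    have h3 := le_csSup (bddAbove_tvSet μ φ₁) h1
    have h4 := le_csSup (bddAbove_tvSet μ φ₂) h2
    have h5 : ∑ i, (μ i).toLin (ψ i)
        = ∑ i, (μ i).toLin (χ i) + ∑ i, (μ i).toLin (ψ i - χ i) := by
      simp
    rw [h5]
    exact add_le_add h3 h4
  · rw [← le_sub_iff_add_le]
    refine csSup_le ⟨0, zero_mem_tvSet μ _⟩ fun r₁ h₁ => ?_
    rw [le_sub_iff_add_le, ← le_sub_iff_add_le']
    refine csSup_le ⟨0, zero_mem_tvSet μ _⟩ fun r₂ h₂ => ?_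
    rw [le_sub_iff_add_le']
    exact le_csSup (bddAbove_tvSet _ _) (add_mem_tvSet μ φ₁ φ₂ h₁ h₂)

/-- `φ ↦ ⟨|μ|, φ⟩` as a linear form on the cone of nonnegative functions of `C_c(X)`. -/
def tvLin (μ : ι → RadonMeasure X) : C_c(X, ℝ≥0) →ₗ[ℝ≥0] ℝ≥0 where
  toFun φ := ⟨tvSup μ φ, tvSup_nonneg μ φ⟩
  map_add' φ₁ φ₂ := NNReal.eq (tvSup_add μ φ₁ φ₂)
  map_smul' c φ := NNReal.eq (tvSup_smul μ c φ)

variable [T2Space X] [LocallyCompactSpace X] [MeasurableSpace X] [BorelSpace X]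

/-- The total variation `|μ|` of a vector Radon measure `μ`, as a positive Borel measure: the
regular Borel measure given by the linear form `φ ↦ ⟨|μ|, φ⟩`. -/
def totalVariation (μ : ι → RadonMeasure X) : Measure X := NNRealRMK.rieszMeasure (tvLin μ)

theorem lintegral_totalVariation (μ : ι → RadonMeasure X) (φ : C_c(X, ℝ≥0)) :
    ∫⁻ x, φ x ∂(totalVariation μ) = ENNReal.ofReal (tvSup μ φ) := by
  rw [totalVariation, NNRealRMK.lintegral_rieszMeasure,
    ENNReal.ofReal_eq_coe_nnreal (tvSup_nonneg μ φ)]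
  rfl

/-- The total variation of a scalar Radon measure. -/
def RadonMeasure.abs (μ : RadonMeasure X) : Measure X := totalVariation fun _ : Unit => μ

end TotalVariation

/-- The integral of a function against a bounded signed Borel measure. -/
def signedIntegral {X : Type*} [MeasurableSpace X] (s : SignedMeasure X) (f : X → ℝ) : ℝ :=
  ∫ x, f x ∂s.toJordanDecomposition.posPart - ∫ x, f x ∂s.toJordanDecomposition.negPart

/-- The Radon measure `μ` is the bounded measure `s`. -/
def RadonMeasure.IsBoundedMeasure {X : Type*} [TopologicalSpace X] [MeasurableSpace X]
    (μ : RadonMeasure X) (s : SignedMeasure X) : Prop :=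
  ∀ φ : C_c(X, ℝ), μ.toLin φ = signedIntegral s φ

/-! ### Distributions and the spaces `BV^p` -/

/-- `ℝ^N` with its Euclidean norm. -/
abbrev Euc (N : ℕ) : Type := EuclideanSpace ℝ (Fin N)

/-- The test functions on `ℝ^N`. -/
abbrev Test (N : ℕ) : Type := 𝓓((⊤ : Opens (Euc N)), ℝ)

/-- A test function as an element of `C_c(ℝ^N)`. -/
def Test.toCc {N : ℕ} (φ : Test N) : C_c(Euc N, ℝ) := ⟨⟨φ, φ.continuous⟩, φ.hasCompactSupport⟩

/-- The partial derivative `∂_i φ`. -/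
def partialDeriv {N : ℕ} (i : Fin N) (φ : Euc N → ℝ) (x : Euc N) : ℝ :=
  fderiv ℝ φ x (EuclideanSpace.single i 1)

/-- `v ∈ L^q_loc(ℝ^N)`. -/
def MemLpLoc {N : ℕ} {F : Type*} [NormedAddCommGroup F] (v : Euc N → F) (q : ℝ≥0∞) : Prop :=
  ∀ K : Set (Euc N), IsCompact K → MemLp v q (volume.restrict K)

/-- The distributional derivative `∂_i u` is the function `d`. -/
def IsWeakPartial {N : ℕ} (i : Fin N) (u d : Euc N → ℝ) : Prop :=
  ∀ φ : Test N, ∫ x, d x * φ x = -∫ x, u x * partialDeriv i φ x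

/-- The distributional derivative `∂_i u` is the Radon measure `μ`. -/
def IsRadonPartial {N : ℕ} (i : Fin N) (u : Euc N → ℝ) (μ : RadonMeasure (Euc N)) : Prop :=
  ∀ φ : Test N, μ.toLin φ.toCc = -∫ x, u x * partialDeriv i φ x

/-- The distributional derivative `∂_i u` is the bounded measure `s`. -/
def IsBoundedPartial {N : ℕ} (i : Fin N) (u : Euc N → ℝ) (s : SignedMeasure (Euc N)) : Prop :=
  ∀ φ : Test N, signedIntegral s φ = -∫ x, u x * partialDeriv i φ x

/-- `σ · ∇φ`. -/
def dotGrad {N : ℕ} (σ : Euc N → Euc N) (φ : Euc N → ℝ) (x : Euc N) : ℝ :=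
  ∑ i, σ x i * partialDeriv i φ x

/-- The distributional divergence of `σ` is the function `g`. -/
def IsWeakDiv {N : ℕ} (σ : Euc N → Euc N) (g : Euc N → ℝ) : Prop :=
  ∀ φ : Test N, ∫ x, g x * φ x = -∫ x, dotGrad σ φ x

/-- `N / p^* = N₁ + ∑_{i > N₁} 1 / p_i - 1`; the components of index `i > N₁` are those with
`N₁ ≤ i` when indices start at `0`. -/
def invExp {N : ℕ} (N₁ : ℕ) (p : Fin N → ℝ) : ℝ :=
  (N₁ : ℝ) + ∑ i ∈ Finset.univ.filter (fun i : Fin N => N₁ ≤ (i : ℕ)), 1 / p i - 1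

/-- The critical exponent `p^*`. -/
def pStar {N : ℕ} (N₁ : ℕ) (p : Fin N → ℝ) : ℝ := (N : ℝ) / invExp N₁ p

/-- The conjugate exponent `q / (q - 1)` of a real number `q > 1`. -/
def conj (q : ℝ) : ℝ≥0∞ := ENNReal.ofReal (q / (q - 1))

/-- The projection `σ^1` of `σ` on the first `N₁` coordinates. -/
def firstProj {N N₁ : ℕ} (h : N₁ ≤ N) (σ : Euc N → Euc N) (x : Euc N) : Euc N₁ :=
  WithLp.toLp 2 fun j => σ x (Fin.castLE h j)

/-- `u ∈ BV^p(ℝ^N)`. -/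
structure MemBV {N : ℕ} (N₁ : ℕ) (p : Fin N → ℝ) (u : Euc N → ℝ) : Prop where
  memLp : MemLp u (ENNReal.ofReal (pStar N₁ p)) volume
  partial_measure : ∀ i : Fin N, (i : ℕ) < N₁ →
    ∃ s : SignedMeasure (Euc N), IsBoundedPartial i u s
  partial_memLp : ∀ i : Fin N, N₁ ≤ (i : ℕ) →
    ∃ d : Euc N → ℝ, MemLp d (ENNReal.ofReal (p i)) volume ∧ IsWeakPartial i u d

/-- `u ∈ BV^p_loc(ℝ^N)`: `φ u ∈ BV^p(ℝ^N)` for every test function `φ`. -/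
def MemBVLoc {N : ℕ} (N₁ : ℕ) (p : Fin N → ℝ) (u : Euc N → ℝ) : Prop :=
  ∀ φ : Test N, MemBV N₁ p fun x => φ x * u x

end

end AnisoBV

namespace AnisoBV

open Filter Topology
open scoped Convolution

noncomputable section

/-! ### Approximation by test functions and extension to Radon measures -/

/-! Mollify `σ` to `σₙ`; then `div σₙ` is the mollification of `div σ`. For a test function `φ` the
components of `σₙ φ` are test functions, so the derivatives of `u` may be tested against them, and
the product rule gives `∑ᵢ ⟨∂ᵢu, σₙᵢ φ⟩ = -∫ (div σₙ) u φ - ∫ (σₙ · ∇φ) u`. Since `u` is locally in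
`L^{p*}`, while `div σ` and all `σᵢ` are locally in the dual space (for `i > N₁` because `pᵢ < p*`),
the right side tends to `⟨σ · ∇u, φ⟩`. On the left, each term with `i > N₁` tends to `∫ σᵢ ∂ᵢu φ`.
Hence `∑_{j ≤ N₁} ⟨∂ⱼu, σₙⱼ φ⟩` tends to the form `σ¹ · ∇₁u` (`tendsto_firstPart`).

If `‖σ¹‖ ≤ M` almost everywhere near the support of `φ`, the same holds for `σₙ¹` on that support
when `n` is large, so these sums are at most `M ⟨|∇₁u|, |φ|⟩` in absolute value
(`abs_firstPart_le`). This estimate carries the local statement: it extends `σ¹ · ∇₁u` to a Radon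
measure, bounds its total variation, and yields absolute continuity through regularity of both
measures. The measure `σ · ∇u` is then recovered by adding the density `∑ σᵢ ∂ᵢu`.

For the global statement, bounded Radon measures become signed measures by Riesz representation of
`(|S| ± S) / 2`. The mass formula comes from testing with cut-offs `φₙ` adapted to the exponents
(`exists_anisotropic_cutoff`). They are dilated by `R^{αᵢ}` in direction `i`, with `αᵢ = 1/pᵢ -
1/p*`. The definition of `p*` says exactly that `∑ αᵢ = 1`, which keeps `∂ᵢφₙ` bounded in
`L^{1/αᵢ}`. By Hölder with exponents `pᵢ'`, `p*` and `1/αᵢ`, the term `∫ (σ · ∇φₙ) u` vanishes in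
the limit. -/

theorem abs_le_of_forall_pos {a b C : ℝ} (h : ∀ ε > 0, a ≤ b + C * ε) : a ≤ b := by
  have h1 : Tendsto (fun ε : ℝ => b + C * ε) (𝓝[>] 0) (𝓝 (b + C * 0)) :=
    (Continuous.tendsto (by fun_prop) _).mono_left nhdsWithin_le_nhds
  rw [mul_zero, add_zero] at h1
  exact ge_of_tendsto h1 (eventually_mem_nhdsWithin.mono fun ε hε => h ε hε)

@[simp]
theorem Test.toCc_apply {N : ℕ} (φ : Test N) (x : Euc N) : φ.toCc x = φ x := rfl

/-- A smooth compactly supported function as a test function. -/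
def mkTest {N : ℕ} (f : Euc N → ℝ) (h : ContDiff ℝ ((⊤ : ℕ∞) : WithTop ℕ∞) f)
    (hc : HasCompactSupport f) : Test N :=
  ⟨f, h, hc, fun _ _ => trivial⟩

@[simp]
theorem mkTest_apply {N : ℕ} (f : Euc N → ℝ) (h : ContDiff ℝ ((⊤ : ℕ∞) : WithTop ℕ∞) f)
    (hc : HasCompactSupport f) (x : Euc N) : mkTest f h hc x = f x := rfl

/-- Removing the values below `ε / 2` leaves a function supported in the closed set `|φ| ≥ ε / 2`,
and the smoothing used does not enlarge supports. Having the support inside the open set `φ ≠ 0`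
leaves room for mollification, so that later a bound on `σ¹` over `tsupport φ` suffices. -/
theorem exists_test_approx {N : ℕ} (φ : C_c(Euc N, ℝ)) {ε : ℝ} (hε : 0 < ε) :
    ∃ ψ : Test N, tsupport ψ ⊆ Function.support φ ∧ ∀ x, |ψ x - φ x| ≤ ε := by
  have hφ : Continuous φ := φ.continuous
  let f : Euc N → ℝ := fun x => φ x - max (-(ε / 2)) (min (ε / 2) (φ x))
  have hf : Continuous f := by fun_prop
  have hsub : tsupport f ⊆ {x | ε / 2 ≤ |φ x|} := by
    refine closure_minimal (fun x hx => ?_) (isClosed_le continuous_const hφ.abs)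
    by_contra h
    simp only [mem_ofPred_eq, not_le, abs_lt] at h
    apply hx
    simp only [f]
    rw [min_eq_right h.2.le, max_eq_right h.1.le, sub_self]
  have hsub' : tsupport f ⊆ Function.support φ := hsub.trans fun x hx h0 => by
    simp only [mem_ofPred_eq, h0, abs_zero] at hx
    linarith
  have hfc : HasCompactSupport f :=
    φ.hasCompactSupport.of_isClosed_subset (isClosed_tsupport f)
      (hsub'.trans (subset_tsupport _))
  obtain ⟨g, hg, hgf, hgs⟩ := hf.exists_contDiff_approx ⊤ (continuous_const (y := ε / 2))
    (fun _ => by positivity)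
  refine ⟨mkTest g hg (hfc.mono hgs), (closure_mono hgs).trans hsub', fun x => ?_⟩
  have h1 := hgf x
  rw [Real.dist_eq] at h1
  have h2 : |f x - φ x| ≤ ε / 2 := by
    simp only [f, sub_sub_cancel_left, abs_neg]
    rw [abs_le]
    exact ⟨le_max_left _ _, max_le (by linarith) (min_le_left _ _)⟩
  calc |g x - φ x| = |(g x - f x) + (f x - φ x)| := by ring_nf
    _ ≤ |g x - f x| + |f x - φ x| := abs_add_le _ _
    _ ≤ ε := by linarith

/-- A linear form on test functions which is bounded, for the uniform norm, on the functions
supported in a given compact set. -/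
def LocallyBounded {N : ℕ} (L : Test N →ₗ[ℝ] ℝ) : Prop :=
  ∀ K : Set (Euc N), IsCompact K → ∃ C : ℝ, ∀ φ : Test N,
    tsupport φ ⊆ K → (∀ x, |φ x| ≤ 1) → |L φ| ≤ C

theorem tsupport_smul_subset' {X : Type*} [TopologicalSpace X] (c : ℝ) (φ : X → ℝ) :
    tsupport (c • φ) ⊆ tsupport φ :=
  closure_mono fun x hx h => hx (by simp [h])

theorem LocallyBounded.exists_bound {N : ℕ} {L : Test N →ₗ[ℝ] ℝ} (hL : LocallyBounded L)
    {K : Set (Euc N)} (hK : IsCompact K) : ∃ C : ℝ, ∀ (φ : Test N) (ε : ℝ), 0 < ε →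
      tsupport φ ⊆ K → (∀ x, |φ x| ≤ ε) → |L φ| ≤ C * ε := by
  obtain ⟨C, hC⟩ := hL K hK
  refine ⟨C, fun φ ε hε hs hb => ?_⟩
  have h := hC (ε⁻¹ • φ) ((tsupport_smul_subset' _ _).trans hs) fun x => by
    have : (ε⁻¹ • φ) x = ε⁻¹ * φ x := rfl
    rw [this, abs_mul, abs_of_pos (inv_pos.2 hε), inv_mul_le_iff₀ hε, mul_one]
    exact hb x
  rw [map_smul, smul_eq_mul, abs_mul, abs_of_pos (inv_pos.2 hε), inv_mul_le_iff₀ hε] at h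
  linarith

theorem RadonMeasure.exists_bound {X : Type*} [TopologicalSpace X] (μ : RadonMeasure X)
    {K : Set X} (hK : IsCompact K) : ∃ C : ℝ, ∀ (φ : C_c(X, ℝ)) (ε : ℝ), 0 < ε →
      tsupport φ ⊆ K → (∀ x, |φ x| ≤ ε) → |μ.toLin φ| ≤ C * ε := by
  obtain ⟨C, hC⟩ := μ.bound K hK
  refine ⟨C, fun φ ε hε hs hb => ?_⟩
  have h := hC (ε⁻¹ • φ) ((tsupport_smul_subset' _ (⇑φ)).trans hs) fun x => by
    rw [CompactlySupportedContinuousMap.smul_apply, smul_eq_mul, abs_mul,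
      abs_of_pos (inv_pos.2 hε), inv_mul_le_iff₀ hε, mul_one]
    exact hb x
  rw [map_smul, smul_eq_mul, abs_mul, abs_of_pos (inv_pos.2 hε), inv_mul_le_iff₀ hε] at h
  linarith

/-- Local boundedness makes `L` Lipschitz for the uniform norm on functions supported in a fixed
compact set, so its values along an approximating sequence are Cauchy. The limit comes with a rate
valid for every approximation, so the sequence can be forgotten afterwards. -/
theorem LocallyBounded.exists_limit {N : ℕ} {L : Test N →ₗ[ℝ] ℝ} (hL : LocallyBounded L)
    (φ : C_c(Euc N, ℝ)) : ∃ l : ℝ, ∀ K : Set (Euc N), IsCompact K → ∃ C : ℝ,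
      ∀ (ψ : Test N) (ε : ℝ), 0 < ε → tsupport ψ ⊆ K → (∀ x, |ψ x - φ x| ≤ ε) →
        |L ψ - l| ≤ C * ε := by
  have hpos : ∀ n : ℕ, (0 : ℝ) < 1 / ((n : ℝ) + 1) := fun n => Nat.one_div_pos_of_nat
  choose ψ hψs hψ using fun n : ℕ => exists_test_approx φ (hpos n)
  have hdiff : ∀ K : Set (Euc N), IsCompact K → ∃ C : ℝ, ∀ (χ : Test N) (ε : ℝ), 0 < ε →
      tsupport χ ⊆ K → (∀ x, |χ x - φ x| ≤ ε) → ∀ n : ℕ,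
        |L χ - L (ψ n)| ≤ C * (ε + 1 / ((n : ℝ) + 1)) := by
    intro K hK
    obtain ⟨C, hC⟩ := hL.exists_bound (hK.union φ.hasCompactSupport.isCompact)
    refine ⟨C, fun χ ε hε hs hb n => ?_⟩
    rw [← map_sub]
    refine hC _ _ (add_pos hε (hpos n)) ?_ fun x => ?_
    · exact (tsupport_sub (⇑χ) (⇑(ψ n))).trans
        (union_subset_union hs ((hψs n).trans (subset_tsupport _)))
    · have : (χ - ψ n) x = (χ x - φ x) - (ψ n x - φ x) := by
        change χ x - ψ n x = _
        ring
      rw [this]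
      exact (abs_sub _ _).trans (add_le_add (hb x) (hψ n x))
  have hlim : Tendsto (fun n : ℕ => 1 / ((n : ℝ) + 1)) atTop (𝓝 0) :=
    tendsto_one_div_add_atTop_nhds_zero_nat
  obtain ⟨C₀, hC₀⟩ := hdiff _ φ.hasCompactSupport.isCompact
  have hC₀' : ∀ m n : ℕ, |L (ψ m) - L (ψ n)| ≤ C₀ * (1 / ((m : ℝ) + 1) + 1 / ((n : ℝ) + 1)) :=
    fun m n => hC₀ _ _ (hpos m) ((hψs m).trans (subset_tsupport _)) (hψ m) n
  have hcau : CauchySeq fun n => L (ψ n) := by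
    refine cauchySeq_of_le_tendsto_0 (fun n : ℕ => |C₀| * (2 * (1 / ((n : ℝ) + 1)))) ?_ ?_
    · intro m n k hm hn
      rw [Real.dist_eq]
      refine (hC₀' m n).trans ?_
      have h1 := one_div_le_one_div_of_le (by positivity : (0 : ℝ) < (k : ℝ) + 1)
        (by exact_mod_cast Nat.succ_le_succ hm : (k : ℝ) + 1 ≤ m + 1)
      have h2 := one_div_le_one_div_of_le (by positivity : (0 : ℝ) < (k : ℝ) + 1)
        (by exact_mod_cast Nat.succ_le_succ hn : (k : ℝ) + 1 ≤ n + 1)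
      refine mul_le_mul (le_abs_self _) (by linarith) (add_pos (hpos m) (hpos n)).le (abs_nonneg _)
    · simpa using (hlim.const_mul 2).const_mul |C₀|
  obtain ⟨l, hl⟩ := cauchySeq_tendsto_of_complete hcau
  refine ⟨l, fun K hK => ?_⟩
  obtain ⟨C, hC⟩ := hdiff K hK
  refine ⟨C, fun χ ε hε hs hb => ?_⟩
  have h1 : Tendsto (fun n : ℕ => C * (ε + 1 / ((n : ℝ) + 1))) atTop (𝓝 (C * (ε + 0))) :=
    (hlim.const_add ε).const_mul C
  rw [add_zero] at h1
  exact le_of_tendsto_of_tendsto' ((tendsto_const_nhds.sub hl).abs) h1 (hC χ ε hε hs hb)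

/-- The extension takes the limits above as its values. Each required identity holds up to `O(ε)` on
test approximations supported in a common compact set, and `ε` is arbitrary. -/
theorem LocallyBounded.exists_radonMeasure {N : ℕ} {L : Test N →ₗ[ℝ] ℝ} (hL : LocallyBounded L) :
    ∃ μ : RadonMeasure (Euc N), ∀ φ : Test N, μ.toLin φ.toCc = L φ := by
  choose l hl using hL.exists_limit
  have heq : ∀ {a b C : ℝ}, (∀ ε > 0, |a - b| ≤ C * ε) → a = b := fun h =>
    sub_eq_zero.1 (abs_nonpos_iff.1 (abs_le_of_forall_pos (b := 0) fun ε hε => by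
      simpa using h ε hε))
  have hadd : ∀ φ₁ φ₂, l (φ₁ + φ₂) = l φ₁ + l φ₂ := by
    intro φ₁ φ₂
    have hK := φ₁.hasCompactSupport.isCompact.union φ₂.hasCompactSupport.isCompact
    obtain ⟨C, hC⟩ := hl (φ₁ + φ₂) _ hK
    obtain ⟨C₁, hC₁⟩ := hl φ₁ _ hK
    obtain ⟨C₂, hC₂⟩ := hl φ₂ _ hK
    refine heq (C := C * 2 + C₁ + C₂) fun ε hε => ?_
    obtain ⟨ψ₁, hs₁, h₁⟩ := exists_test_approx φ₁ hε
    obtain ⟨ψ₂, hs₂, h₂⟩ := exists_test_approx φ₂ hε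
    have hs₁' := (hs₁.trans (subset_tsupport _)).trans
      (subset_union_left (t := tsupport φ₂))
    have hs₂' := (hs₂.trans (subset_tsupport _)).trans
      (subset_union_right (s := tsupport φ₁))
    have e := hC (ψ₁ + ψ₂) (2 * ε) (by positivity)
      ((tsupport_add _ _).trans (union_subset hs₁' hs₂')) fun x => by
        have : (ψ₁ + ψ₂) x - (φ₁ + φ₂) x = (ψ₁ x - φ₁ x) + (ψ₂ x - φ₂ x) := by
          change ψ₁ x + ψ₂ x - (φ₁ x + φ₂ x) = _
          ring
        rw [this]
        refine (abs_add_le _ _).trans ?_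
        linarith [h₁ x, h₂ x]
    have e₁ := hC₁ ψ₁ ε hε hs₁' h₁
    have e₂ := hC₂ ψ₂ ε hε hs₂' h₂
    rw [map_add] at e
    rw [abs_le] at *
    constructor <;> linarith [e.1, e.2, e₁.1, e₁.2, e₂.1, e₂.2]
  have hsmul : ∀ (c : ℝ) φ, l (c • φ) = c * l φ := by
    intro c φ
    have hK := φ.hasCompactSupport.isCompact
    obtain ⟨C, hC⟩ := hl (c • φ) _ hK
    obtain ⟨C₁, hC₁⟩ := hl φ _ hK
    refine heq (C := C * (|c| + 1) + |c| * C₁) fun ε hε => ?_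
    obtain ⟨ψ, hs, h⟩ := exists_test_approx φ hε
    have hs' := hs.trans (subset_tsupport _)
    have e := hC (c • ψ) ((|c| + 1) * ε) (by positivity)
      ((tsupport_smul_subset' _ _).trans hs') fun x => by
        have : (c • ψ) x - (c • φ) x = c * (ψ x - φ x) := by
          change c * ψ x - c * φ x = _
          ring
        rw [this, abs_mul]
        nlinarith [h x, abs_nonneg c]
    have e₁ := hC₁ ψ ε hε hs' h
    rw [map_smul, smul_eq_mul] at e
    calc |l (c • φ) - c * l φ| = |c * (L ψ - l φ) - (c * L ψ - l (c • φ))| := by ring_nf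
      _ ≤ |c * (L ψ - l φ)| + |c * L ψ - l (c • φ)| := abs_sub _ _
      _ ≤ |c| * (C₁ * ε) + C * ((|c| + 1) * ε) := by
        rw [abs_mul]
        exact add_le_add (mul_le_mul_of_nonneg_left e₁ (abs_nonneg c)) e
      _ = _ := by ring
  refine ⟨⟨⟨⟨l, hadd⟩, hsmul⟩, fun K hK => ?_⟩, fun φ => ?_⟩
  · obtain ⟨C, hC⟩ := hL.exists_bound hK
    refine ⟨C, fun φ hs hb => ?_⟩
    obtain ⟨C₁, hC₁⟩ := hl φ _ hK
    refine abs_le_of_forall_pos (C := C + C₁) fun ε hε => ?_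
    obtain ⟨ψ, hs₁, h⟩ := exists_test_approx φ hε
    have hs' := (hs₁.trans (subset_tsupport _)).trans hs
    have e := hC ψ (1 + ε) (by positivity) hs' fun x => by
      have h1 := abs_sub_abs_le_abs_sub (ψ x) (φ x)
      linarith [h x, hb x]
    have e₁ := hC₁ ψ ε hε hs' h
    change |l φ| ≤ _
    have h1 := abs_sub_abs_le_abs_sub (l φ) (L ψ)
    rw [abs_sub_comm] at h1
    linarith
  · obtain ⟨C, hC⟩ := hl φ.toCc _ φ.hasCompactSupport.isCompact
    refine heq (C := C) fun ε hε => ?_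
    have h := hC φ ε hε subset_rfl fun x => by simpa using hε.le
    change |l _ - L φ| ≤ _
    rwa [abs_sub_comm]

/-! ### Comparison of total variations -/

section

variable {X : Type*} [TopologicalSpace X] {ι : Type*} [Fintype ι]

/-- The absolute value of a function of `C_c(X)`. -/
def absCc (φ : C_c(X, ℝ)) : C_c(X, ℝ≥0) := φ.compLeft ⟨nnnorm, continuous_nnnorm⟩

@[simp]
theorem absCc_apply (φ : C_c(X, ℝ)) (x : X) : (absCc φ x : ℝ) = |φ x| := by
  rw [absCc, CompactlySupportedContinuousMap.compLeft_apply (by simp)]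
  simp

theorem abs_sum_le_tvSup (μ : ι → RadonMeasure X) (φ : C_c(X, ℝ≥0)) (ψ : ι → C_c(X, ℝ))
    (h : ∀ x, ∑ i, ψ i x ^ 2 ≤ (φ x : ℝ) ^ 2) : |∑ i, (μ i).toLin (ψ i)| ≤ tvSup μ φ := by
  rw [abs_le']
  refine ⟨le_csSup (bddAbove_tvSet _ _) ⟨ψ, h, rfl⟩,
    le_csSup (bddAbove_tvSet _ _) ⟨fun i => -ψ i, fun x => ?_, by simp⟩⟩
  simpa using h x

theorem tvSup_mono (μ : ι → RadonMeasure X) {φ ψ : C_c(X, ℝ≥0)} (h : ∀ x, φ x ≤ ψ x) :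
    tvSup μ φ ≤ tvSup μ ψ := by
  refine csSup_le ⟨0, zero_mem_tvSet μ _⟩ ?_
  rintro r ⟨χ, hχ, rfl⟩
  refine (le_abs_self _).trans (abs_sum_le_tvSup μ ψ χ fun x => (hχ x).trans ?_)
  have : (φ x : ℝ) ≤ ψ x := by exact_mod_cast h x
  gcongr

theorem tvSup_unit_le (S : RadonMeasure X) (μ : ι → RadonMeasure X) (M : ℝ≥0) (φ : C_c(X, ℝ≥0))
    (h : ∀ ψ : C_c(X, ℝ), (∀ x, |ψ x| ≤ φ x) → |S.toLin ψ| ≤ M * tvSup μ (absCc ψ)) :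
    tvSup (fun _ : Unit => S) φ ≤ M * tvSup μ φ := by
  refine csSup_le ⟨0, zero_mem_tvSet _ _⟩ ?_
  rintro r ⟨χ, hχ, rfl⟩
  have hle : ∀ x, |χ () x| ≤ φ x := fun x =>
    abs_le_of_sq_le_sq (by simpa using hχ x) (φ x).coe_nonneg
  simp only [Finset.univ_unique, PUnit.default_eq_unit, Finset.sum_singleton]
  refine (le_abs_self _).trans ((h _ hle).trans ?_)
  refine mul_le_mul_of_nonneg_left (tvSup_mono μ fun x => ?_) M.coe_nonneg
  rw [← NNReal.coe_le_coe, absCc_apply]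
  exact hle x

end

/-- A domination by a total variation passes from test functions to functions of `C_c`. -/
theorem abs_le_tvSup_of_test {N : ℕ} {ι : Type*} [Fintype ι] (S : RadonMeasure (Euc N))
    (μ : ι → RadonMeasure (Euc N)) (M : ℝ≥0) (φ : C_c(Euc N, ℝ))
    (h : ∀ ψ : Test N, tsupport ψ ⊆ Function.support φ →
      |S.toLin ψ.toCc| ≤ M * tvSup μ (absCc ψ.toCc)) :
    |S.toLin φ| ≤ M * tvSup μ (absCc φ) := by
  have hK := φ.hasCompactSupport.isCompact
  obtain ⟨C, hC⟩ := S.exists_bound hK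
  -- A cut-off equal to `1` on `tsupport φ` turns the uniform error into `|ψ| ≤ |φ| + ε χ`, to which
  -- monotonicity and additivity of `tvSup` apply.
  obtain ⟨χ, hχ1, hχ2, -⟩ := exists_continuousMap_one_of_isCompact_subset_isOpen hK isOpen_univ
    (subset_univ _)
  let χ' : C_c(Euc N, ℝ≥0) := absCc ⟨χ, hasCompactSupport_def.mpr hχ2⟩
  have hχ' : ∀ x ∈ tsupport φ, (χ' x : ℝ) = 1 := fun x hx => by
    have := hχ1 hx
    simp only [χ', absCc_apply, CompactlySupportedContinuousMap.coe_mk]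
    simp [this]
  refine abs_le_of_forall_pos (C := M * tvSup μ χ' + C) fun ε hε => ?_
  obtain ⟨ψ, hs, hb⟩ := exists_test_approx φ hε
  have hs' := hs.trans (subset_tsupport _)
  have h1 := h ψ hs
  have h2 : tvSup μ (absCc ψ.toCc) ≤ tvSup μ (absCc φ) + ε * tvSup μ χ' := by
    lift ε to ℝ≥0 using hε.le
    rw [← tvSup_smul, ← tvSup_add]
    refine tvSup_mono μ fun x => ?_
    rw [← NNReal.coe_le_coe]
    simp only [CompactlySupportedContinuousMap.add_apply, NNReal.coe_add, absCc_apply,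
      Test.toCc_apply, CompactlySupportedContinuousMap.smul_apply, smul_eq_mul, NNReal.coe_mul]
    by_cases hx : x ∈ tsupport ψ
    · rw [hχ' x (hs' hx)]
      linarith [abs_sub_abs_le_abs_sub (ψ x) (φ x), hb x]
    · rw [image_eq_zero_of_notMem_tsupport hx, abs_zero]
      positivity
  have h4 : |S.toLin (φ - ψ.toCc)| ≤ C * ε := by
    refine hC _ ε hε ?_ fun x => ?_
    · exact (tsupport_sub (⇑φ) (⇑ψ.toCc)).trans (union_subset subset_rfl hs')
    · rw [CompactlySupportedContinuousMap.sub_apply, abs_sub_comm]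
      exact hb x
  rw [map_sub] at h4
  have h5 := abs_sub_abs_le_abs_sub (S.toLin φ) (S.toLin ψ.toCc)
  have h6 := mul_le_mul_of_nonneg_left h2 M.coe_nonneg
  linarith

/-! ### Comparison of regular measures -/

section

variable {X : Type*} [TopologicalSpace X] [T2Space X] [LocallyCompactSpace X]

theorem exists_cc_one_of_isCompact {K V : Set X} (hK : IsCompact K) (hV : IsOpen V)
    (hKV : K ⊆ V) : ∃ φ : C_c(X, ℝ≥0), (∀ x ∈ K, φ x = 1) ∧ tsupport φ ⊆ V ∧ ∀ x, φ x ≤ 1 := by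
  obtain ⟨f, hf1, hf2, hf3, hf4⟩ := exists_continuousMap_one_of_isCompact_subset_isOpen hK hV hKV
  refine ⟨CompactlySupportedContinuousMap.nnrealPart ⟨f, hasCompactSupport_def.mpr hf2⟩,
    fun x hx => ?_, (closure_mono fun x hx => ?_).trans hf3, fun x => ?_⟩
  · simp [hf1 hx]
  · rw [Function.mem_support] at hx ⊢
    exact fun h => hx (by simp [h])
  · simpa using (hf4 x).2

variable [MeasurableSpace X] [BorelSpace X]

/-- A Urysohn function between `K` and an open `V ∩ W` gives `μ K ≤ c ν V`, and outer regularity of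
`ν` shrinks `V` to `K`. The set `W` localizes the comparison, as needed when `c` depends on a ball.
-/
theorem measure_isCompact_le_of_lintegral_le {μ ν : Measure X} [ν.OuterRegular]
    [IsFiniteMeasureOnCompacts ν] {c : ℝ≥0} {W : Set X} (hW : IsOpen W)
    (h : ∀ φ : C_c(X, ℝ≥0), tsupport φ ⊆ W → ∫⁻ x, φ x ∂μ ≤ c * ∫⁻ x, φ x ∂ν)
    {K : Set X} (hK : IsCompact K) (hKW : K ⊆ W) : μ K ≤ c * ν K := by
  have key : ∀ V, IsOpen V → K ⊆ V → μ K ≤ c * ν V := by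
    intro V hV hKV
    obtain ⟨φ, h1, h2, h3⟩ := exists_cc_one_of_isCompact hK (hV.inter hW) (subset_inter hKV hKW)
    calc μ K = ∫⁻ x, K.indicator 1 x ∂μ := (lintegral_indicator_one hK.measurableSet).symm
      _ ≤ ∫⁻ x, φ x ∂μ := by
        refine lintegral_mono fun x => ?_
        by_cases hx : x ∈ K
        · simp [hx, h1 x hx]
        · simp [hx]
      _ ≤ c * ∫⁻ x, φ x ∂ν := h φ (h2.trans inter_subset_right)
      _ ≤ c * ∫⁻ x, V.indicator 1 x ∂ν := by
        gcongr with x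
        by_cases hx : x ∈ V
        · simpa [hx] using h3 x
        · have : φ x = 0 := image_eq_zero_of_notMem_tsupport fun hx' => hx (h2 hx').1
          simp [this]
      _ = c * ν V := by rw [lintegral_indicator_one hV.measurableSet]
  refine ENNReal.le_of_forall_pos_le_add fun ε hε _ => ?_
  -- Dividing by `c + 1` rather than `c` also covers `c = 0`.
  obtain ⟨V, hKV, hV, hνV⟩ := K.exists_isOpen_le_add ν
    (ε := ((ε / (c + 1) : ℝ≥0) : ℝ≥0∞)) (by
      rw [Ne, ENNReal.coe_eq_zero]; positivity)
  refine (key V hV hKV).trans ((mul_le_mul_right hνV _).trans ?_)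
  rw [mul_add]
  gcongr
  rw [← ENNReal.coe_mul, ENNReal.coe_le_coe, mul_div_assoc', div_le_iff₀ (by positivity)]
  rw [mul_comm]
  gcongr
  exact le_self_add

theorem measure_le_of_lintegral_le {μ ν : Measure X} [μ.InnerRegular] [ν.OuterRegular]
    [IsFiniteMeasureOnCompacts ν] {c : ℝ≥0} {W : Set X} (hW : IsOpen W)
    (h : ∀ φ : C_c(X, ℝ≥0), tsupport φ ⊆ W → ∫⁻ x, φ x ∂μ ≤ c * ∫⁻ x, φ x ∂ν)
    {A : Set X} (hA : MeasurableSet A) (hAW : A ⊆ W) : μ A ≤ c * ν A := by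
  rw [hA.measure_eq_iSup_isCompact]
  refine iSup₂_le fun K hKA => iSup_le fun hK => ?_
  refine (measure_isCompact_le_of_lintegral_le hW h hK (hKA.trans hAW)).trans ?_
  gcongr

end

/-! ### Bounded Radon measures and signed measures -/

theorem cc_bounded {X : Type*} [TopologicalSpace X] (φ : C_c(X, ℝ)) : ∃ C : ℝ, ∀ x, |φ x| ≤ C :=
  φ.continuous.bounded_above_of_compact_support φ.hasCompactSupport

section

variable {X : Type*} [MeasurableSpace X]

theorem integrable_of_abs_le {μ : Measure X} [IsFiniteMeasure μ] {f : X → ℝ} (hf : Measurable f)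
    {C : ℝ} (hC : ∀ x, |f x| ≤ C) : Integrable f μ :=
  Integrable.of_bound hf.aestronglyMeasurable C (.of_forall hC)

/-- The Jordan parts of `μ - ν` need not be `μ` and `ν`, but positive part plus `ν` equals `μ` plus
negative part as measures; integrating `f` against this identity suffices. -/
theorem signedIntegral_sub_toSignedMeasure (μ ν : Measure X) [IsFiniteMeasure μ]
    [IsFiniteMeasure ν] {f : X → ℝ} (hf : Measurable f) {C : ℝ} (hC : ∀ x, |f x| ≤ C) :
    signedIntegral (μ.toSignedMeasure - ν.toSignedMeasure) f = ∫ x, f x ∂μ - ∫ x, f x ∂ν := by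
  set s := μ.toSignedMeasure - ν.toSignedMeasure with hs
  have h1 : s.toJordanDecomposition.posPart.toSignedMeasure
      - s.toJordanDecomposition.negPart.toSignedMeasure = s :=
    s.toSignedMeasure_toJordanDecomposition
  have h2 : s.toJordanDecomposition.posPart + ν = μ + s.toJordanDecomposition.negPart := by
    rw [← Measure.toSignedMeasure_eq_toSignedMeasure_iff, Measure.toSignedMeasure_add,
      Measure.toSignedMeasure_add]
    rw [hs, sub_eq_iff_eq_add] at h1
    rw [h1]
    abel
  have h3 := congrArg (fun m : Measure X => ∫ x, f x ∂m) h2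
  beta_reduce at h3
  rw [integral_add_measure (integrable_of_abs_le hf hC) (integrable_of_abs_le hf hC),
    integral_add_measure (integrable_of_abs_le hf hC) (integrable_of_abs_le hf hC)] at h3
  unfold signedIntegral
  linarith

theorem abs_signedIntegral_le (s : SignedMeasure X) {f : X → ℝ} {C : ℝ} (hC : ∀ x, |f x| ≤ C) :
    |signedIntegral s f| ≤ C * s.totalVariation.real univ := by
  have h1 := norm_integral_le_of_norm_le_const (μ := s.toJordanDecomposition.posPart)
    (f := f) (C := C) (.of_forall hC)
  have h2 := norm_integral_le_of_norm_le_const (μ := s.toJordanDecomposition.negPart)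
    (f := f) (C := C) (.of_forall hC)
  rw [Real.norm_eq_abs] at h1 h2
  unfold signedIntegral SignedMeasure.totalVariation
  rw [measureReal_add_apply]
  refine (abs_sub _ _).trans ?_
  linarith

theorem signedIntegral_sub (s : SignedMeasure X) {f g : X → ℝ} (hf : Measurable f)
    (hg : Measurable g) {C C' : ℝ} (hC : ∀ x, |f x| ≤ C) (hC' : ∀ x, |g x| ≤ C') :
    signedIntegral s (fun x => f x - g x) = signedIntegral s f - signedIntegral s g := by
  unfold signedIntegral
  rw [integral_sub (integrable_of_abs_le hf hC) (integrable_of_abs_le hg hC'),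
    integral_sub (integrable_of_abs_le hf hC) (integrable_of_abs_le hg hC')]
  ring

theorem tendsto_signedIntegral_univ (s : SignedMeasure X) {f : ℕ → X → ℝ}
    (hf : ∀ n, Measurable (f n)) (hb : ∀ n x, |f n x| ≤ 1)
    (hlim : ∀ x, Tendsto (fun n => f n x) atTop (𝓝 1)) :
    Tendsto (fun n => signedIntegral s (f n)) atTop (𝓝 (s univ)) := by
  have key : ∀ μ : Measure X, [IsFiniteMeasure μ] →
      Tendsto (fun n => ∫ x, f n x ∂μ) atTop (𝓝 (μ.real univ)) := by
    intro μ _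
    have : μ.real univ = ∫ _, (1 : ℝ) ∂μ := by simp
    rw [this]
    exact tendsto_integral_of_dominated_convergence (fun _ => 1)
      (fun n => (hf n).aestronglyMeasurable) (integrable_const _)
      (fun n => .of_forall (hb n)) (.of_forall hlim)
  rw [s.apply_eq_posPart_real_sub_negPart_real MeasurableSet.univ]
  exact (key _).sub (key _)

end

/-- A Radon measure which agrees with a bounded measure on test functions is bounded. -/
theorem isBoundedMeasure_of_test {N : ℕ} (S : RadonMeasure (Euc N)) (s : SignedMeasure (Euc N))
    (h : ∀ φ : Test N, S.toLin φ.toCc = signedIntegral s φ) : S.IsBoundedMeasure s := by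
  intro φ
  obtain ⟨C, hC⟩ := S.exists_bound φ.hasCompactSupport.isCompact
  refine sub_eq_zero.1 (abs_nonpos_iff.1
    (abs_le_of_forall_pos (C := C + s.totalVariation.real univ) fun ε hε => ?_))
  obtain ⟨ψ, hs, hb⟩ := exists_test_approx φ hε
  have h1 : |S.toLin (ψ.toCc - φ)| ≤ C * ε := by
    refine hC _ ε hε ?_ hb
    exact (tsupport_sub (⇑ψ.toCc) (⇑φ)).trans
      (union_subset (hs.trans (subset_tsupport _)) subset_rfl)
  obtain ⟨C₁, hC₁⟩ := cc_bounded φ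
  obtain ⟨C₂, hC₂⟩ := cc_bounded ψ.toCc
  have h2 := abs_signedIntegral_le s hb
  rw [signedIntegral_sub s (map_continuous ψ).measurable (map_continuous φ).measurable hC₂ hC₁,
    ← h] at h2
  rw [map_sub] at h1
  rw [abs_le] at *
  constructor <;> linarith [h1.1, h1.2, h2.1, h2.2]

/-! ### Positive and negative parts of a Radon measure. -/

section

variable {X : Type*} [TopologicalSpace X]

theorem toReal_add' (φ ψ : C_c(X, ℝ≥0)) : (φ + ψ).toReal = φ.toReal + ψ.toReal :=
  CompactlySupportedContinuousMap.toReal_add φ ψ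

theorem abs_toLin_toReal_le (S : RadonMeasure X) (φ : C_c(X, ℝ≥0)) :
    |S.toLin φ.toReal| ≤ tvSup (fun _ : Unit => S) φ := by
  have h := abs_sum_le_tvSup (fun _ : Unit => S) φ (fun _ => φ.toReal) (by simp)
  simpa using h

/-- The positive part `(|S| + S) / 2` of a Radon measure. -/
def posLin (S : RadonMeasure X) : C_c(X, ℝ≥0) →ₗ[ℝ≥0] ℝ≥0 where
  toFun φ := ⟨(tvSup (fun _ : Unit => S) φ + S.toLin φ.toReal) / 2, by
    linarith [(abs_le.1 (abs_toLin_toReal_le S φ)).1]⟩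
  map_add' φ ψ := NNReal.eq <| by
    change (_ + _) / 2 = (_ + _) / 2 + (_ + _) / 2
    rw [tvSup_add, toReal_add', map_add]
    ring
  map_smul' c φ := NNReal.eq <| by
    change (_ + _) / 2 = (c : ℝ) * ((_ + _) / 2)
    rw [tvSup_smul, CompactlySupportedContinuousMap.toReal_smul,
      NNReal.smul_def, map_smul, smul_eq_mul]
    ring

/-- The opposite of a Radon measure. -/
def RadonMeasure.neg (S : RadonMeasure X) : RadonMeasure X where
  toLin := -S.toLin
  bound K hK := by simpa using S.bound K hK

theorem tvSup_le_of_bounded (S : RadonMeasure X) {C : ℝ}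
    (hC : ∀ φ : C_c(X, ℝ), (∀ x, |φ x| ≤ 1) → |S.toLin φ| ≤ C) (φ : C_c(X, ℝ≥0))
    (hφ : ∀ x, φ x ≤ 1) : tvSup (fun _ : Unit => S) φ ≤ C := by
  refine csSup_le ⟨0, zero_mem_tvSet _ _⟩ ?_
  rintro r ⟨χ, hχ, rfl⟩
  simp only [Finset.univ_unique, PUnit.default_eq_unit, Finset.sum_singleton]
  refine (le_abs_self _).trans (hC _ fun x => ?_)
  refine (abs_le_of_sq_le_sq (by simpa using hχ x) (φ x).coe_nonneg).trans ?_
  exact_mod_cast hφ x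

theorem posLin_apply (S : RadonMeasure X) (φ : C_c(X, ℝ≥0)) :
    (posLin S φ : ℝ) = (tvSup (fun _ : Unit => S) φ + S.toLin φ.toReal) / 2 := rfl

theorem tvSup_neg (S : RadonMeasure X) (φ : C_c(X, ℝ≥0)) :
    tvSup (fun _ : Unit => S.neg) φ = tvSup (fun _ : Unit => S) φ := by
  have key : ∀ S : RadonMeasure X,
      tvSet (fun _ : Unit => S.neg) φ ⊆ tvSet (fun _ : Unit => S) φ := by
    rintro S r ⟨ψ, hψ, rfl⟩
    exact ⟨fun i => -ψ i, by simpa using hψ, by simp [RadonMeasure.neg]⟩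
  have hneg : S.neg.neg = S := by
    cases S
    simp [RadonMeasure.neg]
  have h := key S.neg
  rw [hneg] at h
  unfold tvSup
  rw [(key S).antisymm h]

variable [T2Space X] [LocallyCompactSpace X] [MeasurableSpace X] [BorelSpace X]

/-- The mass of a compact set is at most the value of the form on a cut-off between `0` and `1`,
hence at most `C`; inner regularity passes this to the whole space. -/
theorem isFiniteMeasure_posLin [SigmaCompactSpace X] (S : RadonMeasure X) {C : ℝ}
    (hC : ∀ φ : C_c(X, ℝ), (∀ x, |φ x| ≤ 1) → |S.toLin φ| ≤ C) :
    IsFiniteMeasure (NNRealRMK.rieszMeasure (posLin S)) := by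
  refine ⟨lt_of_le_of_lt ?_ (ENNReal.ofReal_lt_top (r := C))⟩
  rw [MeasurableSet.univ.measure_eq_iSup_isCompact]
  refine iSup₂_le fun K _ => iSup_le fun hK => ?_
  obtain ⟨φ, h1, -, h3⟩ := exists_cc_one_of_isCompact hK isOpen_univ (subset_univ _)
  calc _ = ∫⁻ x, K.indicator 1 x ∂_ := (lintegral_indicator_one hK.measurableSet).symm
    _ ≤ ∫⁻ x, φ x ∂_ := by
      refine lintegral_mono fun x => ?_
      by_cases hx : x ∈ K
      · simp [hx, h1 x hx]
      · simp [hx]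
    _ = posLin S φ := NNRealRMK.lintegral_rieszMeasure _ _
    _ ≤ ENNReal.ofReal C := by
      rw [← ENNReal.ofReal_coe_nnreal, posLin_apply]
      refine ENNReal.ofReal_le_ofReal ?_
      have h4 := tvSup_le_of_bounded S hC φ h3
      have h5 := abs_le.1 (abs_toLin_toReal_le S φ)
      linarith [h5.2]

/-- Since `|-S| = |S|`, the forms `(|S| + S) / 2` and `(|S| - S) / 2` are positive with difference
`S`. Their Riesz measures are finite, and their difference represents `S`. -/
theorem exists_signedMeasure_of_bounded [SigmaCompactSpace X] (S : RadonMeasure X) {C : ℝ}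
    (hC : ∀ φ : C_c(X, ℝ), (∀ x, |φ x| ≤ 1) → |S.toLin φ| ≤ C) :
    ∃ s : SignedMeasure X, S.IsBoundedMeasure s := by
  have h1 := isFiniteMeasure_posLin S hC
  have h2 := isFiniteMeasure_posLin S.neg (C := C) (by simpa [RadonMeasure.neg] using hC)
  refine ⟨(NNRealRMK.rieszMeasure (posLin S)).toSignedMeasure
    - (NNRealRMK.rieszMeasure (posLin S.neg)).toSignedMeasure, fun φ => ?_⟩
  obtain ⟨B, hB⟩ := cc_bounded φ
  rw [signedIntegral_sub_toSignedMeasure _ _ (map_continuous φ).measurable hB]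
  have key : ∀ (f : C_c(X, ℝ≥0)), ∫ x, (f x : ℝ) ∂(NNRealRMK.rieszMeasure (posLin S))
      - ∫ x, (f x : ℝ) ∂(NNRealRMK.rieszMeasure (posLin S.neg)) = S.toLin f.toReal := by
    intro f
    rw [NNRealRMK.integral_rieszMeasure, NNRealRMK.integral_rieszMeasure, posLin_apply,
      posLin_apply, tvSup_neg]
    simp only [RadonMeasure.neg, LinearMap.neg_apply]
    ring
  have hdec : φ = φ.nnrealPart.toReal - (-φ).nnrealPart.toReal := by
    rw [CompactlySupportedContinuousMap.nnrealPart_sub_nnrealPart_neg]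
  have hint : ∀ (μ : Measure X) [IsFiniteMeasure μ], ∫ x, φ x ∂μ =
      ∫ x, (φ.nnrealPart x : ℝ) ∂μ - ∫ x, ((-φ).nnrealPart x : ℝ) ∂μ := by
    intro μ _
    rw [← integral_sub]
    · refine integral_congr_ae (.of_forall fun x => ?_)
      conv_lhs => rw [hdec]
      simp
    · obtain ⟨B', hB'⟩ := cc_bounded φ.nnrealPart.toReal
      exact (integrable_of_abs_le φ.nnrealPart.toReal.continuous.measurable hB').congr
        (.of_forall fun x => by simp)
    · obtain ⟨B', hB'⟩ := cc_bounded (-φ).nnrealPart.toReal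
      exact (integrable_of_abs_le (-φ).nnrealPart.toReal.continuous.measurable hB').congr
        (.of_forall fun x => by simp)
  rw [hint, hint]
  conv_lhs => rw [hdec, map_sub, ← key, ← key]
  ring

end

/-! ### Hölder's inequality and mollification -/

theorem integral_norm_mul_le {X : Type*} [MeasurableSpace X] {μ : Measure X} {p q : ℝ≥0∞}
    [p.HolderConjugate q] {f g : X → ℝ} (hf : MemLp f p μ) (hg : MemLp g q μ) :
    ∫ x, ‖f x * g x‖ ∂μ ≤ (eLpNorm f p μ).toReal * (eLpNorm g q μ).toReal := by
  have h := eLpNorm_smul_le_mul_eLpNorm (p := p) (q := q) (r := 1) hg.1 hf.1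
  rw [← ENNReal.toReal_mul]
  rw [integral_norm_eq_lintegral_enorm (f := fun x => f x * g x) (hf.1.mul hg.1)]
  rw [eLpNorm_one_eq_lintegral_enorm] at h
  exact ENNReal.toReal_mono (ENNReal.mul_ne_top hf.2.ne hg.2.ne) h

theorem abs_integral_mul_le {X : Type*} [MeasurableSpace X] {μ : Measure X} {p q : ℝ≥0∞}
    [p.HolderConjugate q] {f g : X → ℝ} (hf : MemLp f p μ) (hg : MemLp g q μ) :
    |∫ x, f x * g x ∂μ| ≤ (eLpNorm f p μ).toReal * (eLpNorm g q μ).toReal :=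
  (norm_integral_le_integral_norm _).trans (integral_norm_mul_le hf hg)

section

variable {N : ℕ}

theorem MemLp.comp_add_right' {q : ℝ≥0∞} {g : Euc N → ℝ} (hg : MemLp g q volume) (s : Euc N) :
    MemLp (fun x => g (x + s)) q volume :=
  hg.comp_measurePreserving (measurePreserving_add_right volume s)

theorem eLpNorm_comp_add_right' {q : ℝ≥0∞} {g : Euc N → ℝ} (hg : MemLp g q volume)
    (s : Euc N) : eLpNorm (fun x => g (x + s)) q volume = eLpNorm g q volume :=
  eLpNorm_comp_measurePreserving hg.1 (measurePreserving_add_right volume s)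

/-- For `w` in `C_c` in place of `v` the function is a convolution, hence continuous. Density of
`C_c` in `L^p` for finite `p` gives the general case, uniformly in `s` because translations preserve
the `L^q` norm of `g`. -/
theorem continuous_integral_mul_translate {p q : ℝ≥0∞} [p.HolderConjugate q] (hp : p ≠ ∞)
    {v g : Euc N → ℝ} (hv : MemLp v p volume) (hg : MemLp g q volume) :
    Continuous fun s => ∫ x, v x * g (x + s) := by
  refine continuous_of_uniform_approx_of_continuous fun U hU => ?_
  obtain ⟨ε, hε, hU⟩ := Metric.mem_uniformity_dist.1 hU
  set G := (eLpNorm g q volume).toReal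
  have hG : 0 ≤ G := ENNReal.toReal_nonneg
  obtain ⟨w, hwc, hw, hwcont, hwp⟩ := hv.exists_hasCompactSupport_eLpNorm_sub_le hp
    (ε := ENNReal.ofReal (ε / (2 * (G + 1)))) (by simp; positivity)
  refine ⟨fun s => ∫ x, w x * g (x + s), ?_, fun s => hU ?_⟩
  · have hgl : LocallyIntegrable g volume :=
      hg.locallyIntegrable (ENNReal.HolderConjugate.one_le q p)
    have hc : HasCompactSupport fun x => w (-x) := hwc.comp_homeomorph (Homeomorph.neg _)
    have h1 := hc.continuous_convolution_right (ContinuousLinearMap.mul ℝ ℝ) hgl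
      (hwcont.comp continuous_neg)
    refine h1.congr fun s => ?_
    rw [convolution_def, ← integral_add_right_eq_self _ s]
    refine integral_congr_ae (.of_forall fun x => ?_)
    simp [mul_comm]
  · rw [dist_eq_norm, ← integral_sub]
    · have h2 := abs_integral_mul_le (hv.sub hwp) (MemLp.comp_add_right' hg s)
      rw [eLpNorm_comp_add_right' hg] at h2
      have h3 : (eLpNorm (v - w) p volume).toReal ≤ ε / (2 * (G + 1)) :=
        ENNReal.toReal_le_of_le_ofReal (by positivity) hw
      have h4 : ∫ x, (v x * g (x + s) - w x * g (x + s)) = ∫ x, (v - w) x * g (x + s) := by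
        refine integral_congr_ae (.of_forall fun x => ?_)
        simp [sub_mul]
      rw [h4]
      refine (h2.trans (mul_le_mul_of_nonneg_right h3 hG)).trans_lt ?_
      rw [div_mul_eq_mul_div, div_lt_iff₀ (by positivity)]
      nlinarith
    · exact hv.integrable_mul (MemLp.comp_add_right' hg s)
    · exact hwp.integrable_mul (MemLp.comp_add_right' hg s)

variable (N) in
/-- A bump function of radius `1 / (n + 1)` at the origin. -/
def bump (n : ℕ) : ContDiffBump (0 : Euc N) where
  rIn := 1 / ((n : ℝ) + 1) / 2
  rOut := 1 / ((n : ℝ) + 1)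
  rIn_pos := by positivity
  rIn_lt_rOut := half_lt_self (by positivity)

variable (N) in
/-- The mollifier obtained by normalizing `bump N n`. -/
def mollifier (n : ℕ) : Euc N → ℝ := (bump N n).normed volume

/-- The mollification of `f`. -/
def moll {F : Type*} [NormedAddCommGroup F] [NormedSpace ℝ F] (n : ℕ) (f : Euc N → F) :
    Euc N → F :=
  mollifier N n ⋆[ContinuousLinearMap.lsmul ℝ ℝ, volume] f

theorem mollifier_contDiff (n : ℕ) :
    ContDiff ℝ ((⊤ : ℕ∞) : WithTop ℕ∞) (mollifier N n) := (bump N n).contDiff_normed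

theorem mollifier_hasCompactSupport (n : ℕ) : HasCompactSupport (mollifier N n) :=
  (bump N n).hasCompactSupport_normed

theorem mollifier_nonneg (n : ℕ) (x : Euc N) : 0 ≤ mollifier N n x :=
  (bump N n).nonneg_normed x

theorem mollifier_integral (n : ℕ) : ∫ x, mollifier N n x = 1 :=
  (bump N n).integral_normed

theorem mollifier_integrable (n : ℕ) : Integrable (mollifier N n) volume :=
  (mollifier_contDiff n).continuous.integrable_of_hasCompactSupport (mollifier_hasCompactSupport n)

theorem mollifier_support (n : ℕ) :
    Function.support (mollifier N n) = Metric.ball 0 (1 / ((n : ℝ) + 1)) :=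
  (bump N n).support_normed_eq

theorem moll_apply {F : Type*} [NormedAddCommGroup F] [NormedSpace ℝ F] (n : ℕ) (f : Euc N → F)
    (x : Euc N) : moll n f x = ∫ t, mollifier N n t • f (x - t) := rfl

theorem moll_contDiff {f : Euc N → ℝ} (hf : LocallyIntegrable f volume) (n : ℕ) :
    ContDiff ℝ ((⊤ : ℕ∞) : WithTop ℕ∞) (moll n f) :=
  (mollifier_hasCompactSupport n).contDiff_convolution_left _ (mollifier_contDiff n) hf

theorem moll_integrand_integrable {F : Type*} [NormedAddCommGroup F] [NormedSpace ℝ F]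
    {f : Euc N → F} (hf : LocallyIntegrable f volume) (n : ℕ) (x : Euc N) :
    Integrable (fun t => mollifier N n t • f (x - t)) volume :=
  (mollifier_hasCompactSupport n).convolutionExists_left (ContinuousLinearMap.lsmul ℝ ℝ)
    (mollifier_contDiff n).continuous hf x

/-- Fubini; joint integrability follows from Hölder for each fixed `t`, with a bound independent of
`t` by translation invariance, multiplied by the integrable mollifier. -/
theorem integral_moll_mul {p q : ℝ≥0∞} [p.HolderConjugate q]
    {v g : Euc N → ℝ} (hv : MemLp v p volume) (hg : MemLp g q volume) (n : ℕ) :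
    ∫ x, moll n g x * v x = ∫ t, mollifier N n t * ∫ x, v x * g (x + -t) := by
  have hm : AEStronglyMeasurable
      (fun z : Euc N × Euc N => mollifier N n z.2 * g (z.1 - z.2) * v z.1)
      (volume.prod volume) := by
    refine AEStronglyMeasurable.mul ?_ hv.1.comp_fst
    exact (mollifier_contDiff (N := N) n).continuous.aestronglyMeasurable.convolution_integrand
      (ContinuousLinearMap.lsmul ℝ ℝ) hg.1
  have hint : ∀ t, Integrable (fun x => v x * g (x + -t)) volume := fun t =>
    hv.integrable_mul (MemLp.comp_add_right' hg (-t))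
  have hi : Integrable
      (fun z : Euc N × Euc N => mollifier N n z.2 * g (z.1 - z.2) * v z.1)
      (volume.prod volume) := by
    rw [integrable_prod_iff' hm]
    refine ⟨.of_forall fun t => ?_, ?_⟩
    · refine ((hint t).const_mul (mollifier N n t)).congr (.of_forall fun x => ?_)
      simp only [sub_eq_add_neg]
      ring
    · refine Integrable.mono' ((mollifier_integrable (N := N) n).mul_const
        ((eLpNorm v p volume).toReal * (eLpNorm g q volume).toReal))
        hm.norm.prod_swap.integral_prod_right' (.of_forall fun t => ?_)
      have h1 := integral_norm_mul_le hv (MemLp.comp_add_right' hg (-t))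
      rw [eLpNorm_comp_add_right' hg] at h1
      rw [Real.norm_of_nonneg (integral_nonneg fun _ => norm_nonneg _)]
      have h2 : ∀ x, ‖mollifier N n t * g (x - t) * v x‖
          = mollifier N n t * ‖v x * g (x + -t)‖ := fun x => by
        rw [mul_assoc, norm_mul, Real.norm_of_nonneg (mollifier_nonneg n t), mul_comm (v x),
          sub_eq_add_neg]
      simp only [h2]
      rw [integral_const_mul]
      exact mul_le_mul_of_nonneg_left h1 (mollifier_nonneg n t)
  have h := integral_integral_swap (f := fun x t => mollifier N n t * g (x - t) * v x) hi
  calc ∫ x, moll n g x * v x = ∫ x, ∫ t, mollifier N n t * g (x - t) * v x := by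
        refine integral_congr_ae (.of_forall fun x => ?_)
        simp only [moll_apply, smul_eq_mul]
        rw [integral_mul_const]
    _ = ∫ t, ∫ x, mollifier N n t * g (x - t) * v x := h
    _ = _ := by
        refine integral_congr_ae (.of_forall fun t => ?_)
        simp only
        rw [← integral_const_mul]
        refine integral_congr_ae (.of_forall fun x => ?_)
        simp only [sub_eq_add_neg]
        ring

/-- The pairing averages the continuous function `s ↦ ∫ v g(· + s)` against an approximate identity
at `0`. Only weak convergence of the mollifications is used, so `q = ∞` is allowed. -/
theorem tendsto_integral_moll_mul_of_memLp {p q : ℝ≥0∞} [p.HolderConjugate q] (hp : p ≠ ∞)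
    {v g : Euc N → ℝ} (hv : MemLp v p volume) (hg : MemLp g q volume) :
    Tendsto (fun n => ∫ x, moll n g x * v x) atTop (𝓝 (∫ x, g x * v x)) := by
  simp only [integral_moll_mul hv hg]
  have h := ContDiffBump.convolution_tendsto_right_of_continuous (μ := (volume : Measure (Euc N)))
    (φ := bump N) (l := atTop) tendsto_one_div_add_atTop_nhds_zero_nat
    (continuous_integral_mul_translate hp hv hg) 0
  simp only [convolution_def, zero_sub, ContinuousLinearMap.lsmul_apply, smul_eq_mul,
    add_zero] at h
  simpa only [mul_comm (g _)] using! h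

theorem moll_congr {F : Type*} [NormedAddCommGroup F] [NormedSpace ℝ F] {f g : Euc N → F}
    (n : ℕ) {x : Euc N} (h : ∀ y ∈ Metric.ball x (1 / ((n : ℝ) + 1)), f y = g y) :
    moll n f x = moll n g x := by
  simp only [moll_apply]
  refine integral_congr_ae (.of_forall fun t => ?_)
  by_cases ht : t ∈ Function.support (mollifier N n)
  · rw [mollifier_support] at ht
    simp only
    rw [h (x - t) (by simpa using ht)]
  · rw [Function.notMem_support] at ht
    simp [ht]

/-- An average of vectors of norm at most `M` has norm at most `M`. Working with vectors keeps the
Euclidean norm sharp; bounding components separately would lose a dimensional factor. -/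
theorem norm_moll_le {F : Type*} [NormedAddCommGroup F] [NormedSpace ℝ F] {f : Euc N → F} {M : ℝ}
    {U : Set (Euc N)} (hU : ∀ᵐ y ∂volume, y ∈ U → ‖f y‖ ≤ M) (n : ℕ) {x : Euc N}
    (h : Metric.ball x (1 / ((n : ℝ) + 1)) ⊆ U) : ‖moll n f x‖ ≤ M := by
  have hM : ∀ᵐ t ∂(volume : Measure (Euc N)),
      ‖mollifier N n t • f (x - t)‖ ≤ mollifier N n t * M := by
    have h1 :=
      (Measure.measurePreserving_sub_left (volume : Measure (Euc N)) x).quasiMeasurePreserving.ae hU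
    filter_upwards [h1] with t ht
    rw [norm_smul, Real.norm_of_nonneg (mollifier_nonneg n t)]
    by_cases ht0 : t ∈ Function.support (mollifier N n)
    · rw [mollifier_support] at ht0
      exact mul_le_mul_of_nonneg_left (ht (h (by simpa using ht0))) (mollifier_nonneg n t)
    · rw [Function.notMem_support] at ht0
      simp [ht0]
  have h2 := norm_integral_le_of_norm_le ((mollifier_integrable (N := N) n).mul_const M) hM
  rw [integral_mul_const, mollifier_integral, one_mul] at h2
  exact h2

theorem MemLpLoc.locallyIntegrable {F : Type*} [NormedAddCommGroup F] {f : Euc N → F} {q : ℝ≥0∞}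
    (hq : 1 ≤ q) (hf : MemLpLoc f q) : LocallyIntegrable f volume := by
  rw [locallyIntegrable_iff]
  intro K hK
  have := hK.measure_lt_top (μ := (volume : Measure (Euc N)))
  have : IsFiniteMeasure (volume.restrict K) := ⟨by simpa using this⟩
  exact (hf K hK).integrable hq

/-- All mollifiers have radius at most `1`, so the pairing only sees `g` on the closed
`1`-neighbourhood of the support of `v`, and `g` may be cut off outside it. -/
theorem tendsto_integral_moll_mul {p q : ℝ≥0∞} [p.HolderConjugate q] (hp : p ≠ ∞)
    {v g : Euc N → ℝ} (hv : MemLp v p volume) (hvc : HasCompactSupport v) (hg : MemLpLoc g q) :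
    Tendsto (fun n => ∫ x, moll n g x * v x) atTop (𝓝 (∫ x, g x * v x)) := by
  set K := Metric.cthickening 1 (tsupport v)
  have hK : IsCompact K := hvc.isCompact.cthickening
  have hG : MemLp (K.indicator g) q volume :=
    (memLp_indicator_iff_restrict hK.measurableSet).2 (hg K hK)
  have h := tendsto_integral_moll_mul_of_memLp hp hv hG
  have e1 : ∫ x, K.indicator g x * v x = ∫ x, g x * v x := by
    refine integral_congr_ae (.of_forall fun x => ?_)
    by_cases hx : x ∈ tsupport v
    · have hxK : x ∈ K := Metric.self_subset_cthickening _ hx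
      simp [hxK]
    · simp [image_eq_zero_of_notMem_tsupport hx]
  have e2 : ∀ n, ∫ x, moll n (K.indicator g) x * v x = ∫ x, moll n g x * v x := fun n => by
    refine integral_congr_ae (.of_forall fun x => ?_)
    by_cases hx : x ∈ tsupport v
    · simp only
      rw [moll_congr n fun y hy => indicator_of_mem ?_ g]
      refine Metric.mem_cthickening_of_dist_le y x _ _ hx ?_
      refine (Metric.mem_ball.1 hy).le.trans ?_
      rw [div_le_one (by positivity)]
      simp
    · simp [image_eq_zero_of_notMem_tsupport hx]
  simpa only [e1, e2] using h

theorem moll_proj {m : ℕ} {τ : Euc N → Euc m} (hτ : LocallyIntegrable τ volume) (n : ℕ)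
    (x : Euc N) (j : Fin m) : moll n τ x j = moll n (fun y => τ y j) x := by
  have h := (EuclideanSpace.proj (𝕜 := ℝ) (ι := Fin m) j).integral_comp_comm
    (moll_integrand_integrable hτ n x)
  simpa [moll_apply] using h.symm

theorem partialDeriv_moll {f : Euc N → ℝ} (hf : LocallyIntegrable f volume) (n : ℕ) (i : Fin N)
    (x : Euc N) :
    partialDeriv i (moll n f) x = ∫ y, f y * partialDeriv i (mollifier N n) (x - y) := by
  have hc := mollifier_hasCompactSupport (N := N) n
  have hd := mollifier_contDiff (N := N) n
  have h := hc.hasFDerivAt_convolution_left (ContinuousLinearMap.lsmul ℝ ℝ)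
    (hd.of_le (by exact_mod_cast le_top)) hf x
  have hex : Integrable (fun t => ((ContinuousLinearMap.lsmul ℝ ℝ).precompL (Euc N))
      (fderiv ℝ (mollifier N n) t) (f (x - t))) volume :=
    (hc.fderiv ℝ).convolutionExists_left _
      (hd.continuous_fderiv (by simp)) hf x
  rw [partialDeriv, moll, h.fderiv, convolution_def, ContinuousLinearMap.integral_apply hex]
  rw [← integral_sub_left_eq_self _ volume x]
  refine integral_congr_ae (.of_forall fun t => ?_)
  simp [ContinuousLinearMap.precompL_apply, partialDeriv, mul_comm]

/-- The mollifier centered at `x`, as a test function. -/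
def mollifierAt (n : ℕ) (x : Euc N) : Test N :=
  mkTest (fun y => mollifier N n (x - y))
    ((mollifier_contDiff n).comp (contDiff_const.sub contDiff_id))
    ((mollifier_hasCompactSupport n).comp_homeomorph (Homeomorph.subLeft x))

theorem partialDeriv_mollifierAt (n : ℕ) (x : Euc N) (i : Fin N) (y : Euc N) :
    partialDeriv i (mollifierAt n x) y = -partialDeriv i (mollifier N n) (x - y) := by
  have hd := (mollifier_contDiff (N := N) n).differentiable (by simp) (x - y)
  have h : HasFDerivAt (fun y => mollifier N n (x - y))
      ((fderiv ℝ (mollifier N n) (x - y)).comp (-ContinuousLinearMap.id ℝ (Euc N))) y :=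
    hd.hasFDerivAt.comp y ((hasFDerivAt_id y).const_sub x)
  change fderiv ℝ (fun y => mollifier N n (x - y)) y _ = _
  rw [h.fderiv]
  simp [partialDeriv]

/-- The weak divergence is tested on `y ↦ ρₙ(x - y)`, where `ρₙ` is the mollifier; the sign from
differentiating in `y` cancels the sign of the integration by parts. -/
theorem div_moll {σ : Euc N → Euc N} {g : Euc N → ℝ} (h : IsWeakDiv σ g)
    (hσ : ∀ i, LocallyIntegrable (fun x => σ x i) volume) (n : ℕ) (x : Euc N) :
    ∑ i, partialDeriv i (moll n fun y => σ y i) x = moll n g x := by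
  have h1 := h (mollifierAt n x)
  have h2 : moll n g x = ∫ y, g y * mollifierAt n x y := by
    rw [moll_apply, ← integral_sub_left_eq_self _ volume x]
    refine integral_congr_ae (.of_forall fun t => ?_)
    simp only [sub_sub_cancel, smul_eq_mul, mul_comm]
    rfl
  rw [h2, h1]
  simp only [partialDeriv_moll (hσ _), dotGrad, partialDeriv_mollifierAt]
  rw [← integral_neg, ← integral_finsetSum]
  · simp
  · intro i _
    have hc : HasCompactSupport (partialDeriv i (mollifier N n)) :=
      (mollifier_hasCompactSupport (N := N) n).fderiv_apply ℝ _
    have hcont : Continuous (partialDeriv i (mollifier N n)) :=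
      ((mollifier_contDiff (N := N) n).continuous_fderiv (by simp)).clm_apply continuous_const
    exact hc.convolutionExists_right (ContinuousLinearMap.mul ℝ ℝ) (hσ i) hcont x

end

/-! ### Test functions, their derivatives and integrals -/

section

variable {N : ℕ}

theorem Test.integrable_mul (φ : Test N) {f : Euc N → ℝ} (hf : LocallyIntegrable f volume) :
    Integrable (fun x => f x * φ x) volume := by
  have h := TestFunction.integrable_bilin (ContinuousLinearMap.mul ℝ ℝ)
    (hf.locallyIntegrableOn ((⊤ : Opens (Euc N)) : Set (Euc N))) φ
  simpa [mul_comm] using h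

/-- The distribution given by a locally integrable function. -/
def integralCLM (f : Euc N → ℝ) : Test N →L[ℝ] ℝ :=
  TestFunction.integralAgainstBilinCLM (ContinuousLinearMap.mul ℝ ℝ) volume f

theorem integralCLM_apply {f : Euc N → ℝ} (hf : LocallyIntegrable f volume) (φ : Test N) :
    integralCLM f φ = ∫ x, f x * φ x := by
  rw [integralCLM, TestFunction.integralAgainstBilinCLM_eq_integral (hf.locallyIntegrableOn _)]
  simp [mul_comm]

/-- The partial derivative `∂_i`, as a continuous linear map between test functions. -/
def partialCLM (i : Fin N) : Test N →L[ℝ] Test N :=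
  TestFunction.lineDerivCLM ℝ (EuclideanSpace.single i 1)

theorem partialCLM_apply (i : Fin N) (φ : Test N) (x : Euc N) :
    partialCLM i φ x = partialDeriv i φ x := by
  rw [partialCLM, TestFunction.lineDerivCLM_eq_fderivCLM,
    TestFunction.fderivCLM_apply_of_le _ (by simp)]
  rfl

theorem coe_partialCLM (i : Fin N) (φ : Test N) :
    (partialCLM i φ : Euc N → ℝ) = partialDeriv i φ := funext (partialCLM_apply i φ)

theorem tsupport_partialDeriv (i : Fin N) (φ : Euc N → ℝ) :
    tsupport (partialDeriv i φ) ⊆ tsupport φ :=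
  tsupport_fderiv_apply_subset ℝ _

theorem exists_test_one {K : Set (Euc N)} (hK : IsCompact K) :
    ∃ χ : Test N, ∀ x ∈ K, χ x = 1 := by
  obtain ⟨R, hR, hKR⟩ := hK.isBounded.subset_closedBall_lt 0 0
  let b : ContDiffBump (0 : Euc N) := ⟨R, R + 1, hR, by linarith⟩
  exact ⟨mkTest b b.contDiff b.hasCompactSupport, fun x hx =>
    b.one_of_mem_closedBall (hKR hx)⟩

/-- The product of a smooth function and a test function. -/
def mulTest (f : Euc N → ℝ) (hf : ContDiff ℝ ((⊤ : ℕ∞) : WithTop ℕ∞) f) (φ : Test N) : Test N :=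
  mkTest (fun x => f x * φ x) (hf.mul φ.contDiff) φ.hasCompactSupport.mul_left

theorem mulTest_apply (f : Euc N → ℝ) (hf : ContDiff ℝ ((⊤ : ℕ∞) : WithTop ℕ∞) f) (φ : Test N)
    (x : Euc N) : mulTest f hf φ x = f x * φ x := rfl

theorem partialDeriv_mulTest (f : Euc N → ℝ) (hf : ContDiff ℝ ((⊤ : ℕ∞) : WithTop ℕ∞) f)
    (φ : Test N) (i : Fin N) (x : Euc N) :
    partialDeriv i (mulTest f hf φ) x = f x * partialDeriv i φ x + partialDeriv i f x * φ x := by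
  have h1 := (hf.differentiable (by simp) x).hasFDerivAt
  have h2 := (φ.contDiff.differentiable (by simp) x).hasFDerivAt
  have h3 : HasFDerivAt (fun x => f x * φ x) _ x := h1.mul h2
  change fderiv ℝ (fun x => f x * φ x) x _ = _
  rw [h3.fderiv]
  simp [partialDeriv, mul_comm]

theorem contDiff_partialDeriv {f : Euc N → ℝ} (hf : ContDiff ℝ ((⊤ : ℕ∞) : WithTop ℕ∞) f)
    (i : Fin N) : ContDiff ℝ ((⊤ : ℕ∞) : WithTop ℕ∞) (partialDeriv i f) :=
  (hf.fderiv_right (m := ((⊤ : ℕ∞) : WithTop ℕ∞)) (by simp)).clm_apply contDiff_const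

/-! ### Local spaces -/

theorem MemLpLoc.mono_exponent {F : Type*} [NormedAddCommGroup F] {f : Euc N → F} {p q : ℝ≥0∞}
    (hpq : p ≤ q) (hf : MemLpLoc f q) : MemLpLoc f p := by
  intro K hK
  have : IsFiniteMeasure (volume.restrict K) := ⟨by simpa using hK.measure_lt_top⟩
  exact (hf K hK).mono_exponent hpq

theorem MemLpLoc.mul_cc {f v : Euc N → ℝ} {q : ℝ≥0∞} (hf : MemLpLoc f q) (hv : Continuous v)
    (hvc : HasCompactSupport v) : MemLp (fun x => f x * v x) q volume := by
  have hK := hvc.isCompact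
  have h1 : MemLp (fun x => f x * v x) q (volume.restrict (tsupport v)) :=
    MemLp.mul (p := q) (q := ∞) (r := q) (hv.memLp_top_of_hasCompactSupport hvc _) (hf _ hK)
  rw [← memLp_indicator_iff_restrict hK.measurableSet] at h1
  refine h1.ae_eq (.of_forall fun x => ?_)
  by_cases hx : x ∈ tsupport v
  · simp [hx]
  · simp [hx, image_eq_zero_of_notMem_tsupport hx]

theorem MemLpLoc.mul_locallyIntegrable {f g : Euc N → ℝ} {p q : ℝ≥0∞} [p.HolderConjugate q]
    (hf : MemLpLoc f p) (hg : MemLpLoc g q) : LocallyIntegrable (fun x => f x * g x) volume := by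
  rw [locallyIntegrable_iff]
  exact fun K hK => (hf K hK).integrable_mul (hg K hK)

theorem memLpLoc_of_test {u : Euc N → ℝ} {q : ℝ≥0∞}
    (h : ∀ χ : Test N, MemLp (fun x => χ x * u x) q volume) : MemLpLoc u q := by
  intro K hK
  obtain ⟨χ, hχ⟩ := exists_test_one hK
  refine ((h χ).restrict K).ae_eq ?_
  filter_upwards [ae_restrict_mem hK.measurableSet] with x hx
  rw [hχ x hx, one_mul]

theorem integral_cutoff_mul_partialDeriv {u : Euc N → ℝ} {χ φ : Test N} {K : Set (Euc N)}
    (hχ : ∀ x ∈ K, χ x = 1) (hφ : tsupport φ ⊆ K) (i : Fin N) :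
    ∫ x, χ x * u x * partialDeriv i φ x = ∫ x, u x * partialDeriv i φ x := by
  refine integral_congr_ae (.of_forall fun x => ?_)
  by_cases hx : x ∈ K
  · simp [hχ x hx]
  · simp only
    rw [image_eq_zero_of_notMem_tsupport fun h => hx (hφ (tsupport_partialDeriv i φ h)),
      mul_zero, mul_zero]

/-- On test functions supported in `K`, a cut-off `χ` equal to `1` on `K` makes `∂ᵢu` agree with the
bounded measure `∂ᵢ(χu)`, whose total mass is the required local bound. -/
theorem exists_isRadonPartial {u : Euc N → ℝ} (hu : LocallyIntegrable u volume) (i : Fin N)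
    (h : ∀ χ : Test N, ∃ s : SignedMeasure (Euc N), IsBoundedPartial i (fun x => χ x * u x) s) :
    ∃ μ : RadonMeasure (Euc N), IsRadonPartial i u μ := by
  have hL : ∀ φ, (-(integralCLM u ∘L partialCLM i)) φ = -∫ x, u x * partialDeriv i φ x := by
    intro φ
    change -(integralCLM u (partialCLM i φ)) = _
    rw [integralCLM_apply hu, coe_partialCLM]
  have hb : LocallyBounded (-(integralCLM u ∘L partialCLM i)).toLinearMap := by
    intro K hK
    obtain ⟨χ, hχ⟩ := exists_test_one hK
    obtain ⟨s, hs⟩ := h χ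
    refine ⟨1 * s.totalVariation.real univ, fun φ hφ hφ1 => ?_⟩
    have h1 := hs φ
    rw [integral_cutoff_mul_partialDeriv hχ hφ, ← hL] at h1
    change |(-(integralCLM u ∘L partialCLM i)) φ| ≤ _
    rw [← h1]
    exact abs_signedIntegral_le s hφ1
  obtain ⟨μ, hμ⟩ := hb.exists_radonMeasure
  exact ⟨μ, fun φ => (hμ φ).trans (hL φ)⟩

/-- Weak derivatives of functions which agree on an open set agree there. -/
theorem ae_eq_of_isWeakPartial {i : Fin N} {U : Set (Euc N)} (hU : IsOpen U)
    {u₁ u₂ d₁ d₂ : Euc N → ℝ} (h₁ : LocallyIntegrable d₁ volume)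
    (h₂ : LocallyIntegrable d₂ volume) (hd₁ : IsWeakPartial i u₁ d₁) (hd₂ : IsWeakPartial i u₂ d₂)
    (hu : ∀ x ∈ U, u₁ x = u₂ x) : ∀ᵐ x ∂volume, x ∈ U → d₁ x = d₂ x := by
  have h := hU.ae_eq_zero_of_integral_contDiff_smul_eq_zero (μ := (volume : Measure (Euc N)))
    (f := fun x => d₁ x - d₂ x) ((h₁.sub h₂).locallyIntegrableOn _) fun g hg hgc hgU => ?_
  · filter_upwards [h] with x hx hxU using sub_eq_zero.1 (hx hxU)
  · let φ := mkTest g hg hgc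
    have e : ∀ x, g x • (d₁ x - d₂ x) = d₁ x * φ x - d₂ x * φ x := fun x => by
      simp only [smul_eq_mul, φ, mkTest_apply]
      ring
    simp only [e]
    rw [integral_sub (φ.integrable_mul h₁) (φ.integrable_mul h₂), hd₁ φ, hd₂ φ]
    have : ∀ x, u₁ x * partialDeriv i φ x = u₂ x * partialDeriv i φ x := fun x => by
      by_cases hx : x ∈ U
      · rw [hu x hx]
      · rw [image_eq_zero_of_notMem_tsupport fun h => hx (hgU (tsupport_partialDeriv i φ h)),
          mul_zero, mul_zero]
    simp [this]

theorem exists_isWeakPartial {u : Euc N → ℝ} {q : ℝ≥0∞} (hq : 1 ≤ q) (i : Fin N)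
    (h : ∀ χ : Test N, ∃ d : Euc N → ℝ, MemLp d q volume ∧
      IsWeakPartial i (fun x => χ x * u x) d) :
    ∃ d : Euc N → ℝ, MemLpLoc d q ∧ IsWeakPartial i u d := by
  choose χ hχ using fun n : ℕ => exists_test_one (isCompact_closedBall (0 : Euc N) n)
  choose d hd hdw using fun n => h (χ n)
  have hdl : ∀ n, LocallyIntegrable (d n) volume := fun n => (hd n).locallyIntegrable hq
  -- The derivatives of the cut-off functions agree almost everywhere on the smaller balls, so they
  -- can be glued. The `+ 1` places `x` in the open ball whose radius is the chosen index.
  let D : Euc N → ℝ := fun x => d (⌊‖x‖⌋₊ + 1) x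
  have hball : ∀ m n : ℕ, m ≤ n → ∀ᵐ x ∂volume, x ∈ Metric.ball (0 : Euc N) m → d m x = d n x := by
    intro m n hmn
    refine ae_eq_of_isWeakPartial Metric.isOpen_ball (hdl m) (hdl n) (hdw m) (hdw n)
      fun x hx => ?_
    have hx' := Metric.ball_subset_closedBall hx
    rw [hχ m x hx', hχ n x (Metric.closedBall_subset_closedBall (by exact_mod_cast hmn) hx')]
  have hD : ∀ n : ℕ, ∀ᵐ x ∂volume, x ∈ Metric.ball (0 : Euc N) n → D x = d n x := by
    intro n
    have h1 : ∀ᵐ x ∂(volume : Measure (Euc N)), ∀ m : ℕ, m ≤ n →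
        x ∈ Metric.ball (0 : Euc N) m → d m x = d n x := by
      rw [ae_all_iff]
      intro m
      by_cases hmn : m ≤ n
      · filter_upwards [hball m n hmn] with x hx _ using hx
      · exact .of_forall fun x h => absurd h hmn
    filter_upwards [h1] with x hx hxn
    rw [mem_ball_zero_iff] at hxn
    refine hx _ (Nat.succ_le_of_lt ((Nat.floor_lt (norm_nonneg x)).2 hxn)) ?_
    rw [mem_ball_zero_iff]
    exact_mod_cast Nat.lt_floor_add_one ‖x‖
  have hbdd : ∀ K : Set (Euc N), IsCompact K → ∃ n : ℕ, K ⊆ Metric.ball (0 : Euc N) n := by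
    intro K hK
    obtain ⟨R, hR⟩ := hK.isBounded.subset_ball 0
    obtain ⟨n, hn⟩ := exists_nat_ge R
    exact ⟨n, hR.trans (Metric.ball_subset_ball hn)⟩
  refine ⟨D, fun K hK => ?_, fun φ => ?_⟩
  · obtain ⟨n, hn⟩ := hbdd K hK
    refine ((hd n).restrict K).ae_eq ?_
    filter_upwards [ae_restrict_of_ae (hD n), ae_restrict_mem hK.measurableSet] with x h1 h2
    exact (h1 (hn h2)).symm
  · obtain ⟨n, hn⟩ := hbdd _ φ.hasCompactSupport.isCompact
    have h1 := hdw n φ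
    rw [integral_cutoff_mul_partialDeriv (hχ n) (hn.trans Metric.ball_subset_closedBall)] at h1
    rw [← h1]
    refine integral_congr_ae ?_
    filter_upwards [hD n] with x hx
    by_cases hxs : x ∈ tsupport φ
    · rw [hx (hn hxs)]
    · rw [image_eq_zero_of_notMem_tsupport hxs, mul_zero, mul_zero]

/-- A Radon measure plus a locally integrable density. -/
def RadonMeasure.addDensity (S : RadonMeasure (Euc N)) (g : Euc N → ℝ)
    (hg : LocallyIntegrable g volume) : RadonMeasure (Euc N) where
  toLin :=
    { toFun := fun φ => S.toLin φ + ∫ x, g x * φ x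
      map_add' := fun φ ψ => by
        have hi : ∀ φ : C_c(Euc N, ℝ), Integrable (fun x => g x * φ x) volume := fun φ => by
          simpa [mul_comm] using hg.integrable_smul_left_of_hasCompactSupport
            (map_continuous φ) φ.hasCompactSupport
        simp only [map_add, CompactlySupportedContinuousMap.add_apply, mul_add]
        rw [integral_add (hi φ) (hi ψ)]
        ring
      map_smul' := fun c φ => by
        simp only [map_smul, CompactlySupportedContinuousMap.smul_apply, smul_eq_mul,
          RingHom.id_apply, mul_left_comm _ c]
        rw [integral_const_mul]
        ring }
  bound K hK := by
    obtain ⟨C, hC⟩ := S.bound K hK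
    refine ⟨C + ∫ x in K, ‖g x‖, fun φ hs hb => (abs_add_le _ _).trans
      (add_le_add (hC φ hs hb) ?_)⟩
    have e : ∫ x in K, g x * φ x = ∫ x, g x * φ x :=
      setIntegral_eq_integral_of_forall_compl_eq_zero fun x hx => by
        rw [image_eq_zero_of_notMem_tsupport fun h => hx (hs h), mul_zero]
    rw [← e, ← Real.norm_eq_abs]
    refine norm_integral_le_of_norm_le (hg.integrableOn_isCompact hK).norm (.of_forall fun x => ?_)
    rw [norm_mul]
    exact mul_le_of_le_one_right (norm_nonneg _) (hb x)

theorem RadonMeasure.addDensity_apply (S : RadonMeasure (Euc N)) (g : Euc N → ℝ)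
    (hg : LocallyIntegrable g volume) (φ : C_c(Euc N, ℝ)) :
    (S.addDensity g hg).toLin φ = S.toLin φ + ∫ x, g x * φ x := rfl

end

/-! ### The distribution `σ · ∇u` and the measure `σ¹ · ∇₁u` -/

section

variable {N : ℕ}

/-- The distribution `φ ↦ -∫ g u φ - ∫ (σ · ∇φ) u`, where `g` stands for `div σ`. -/
def transportCLM (σ : Euc N → Euc N) (g u : Euc N → ℝ) : Test N →L[ℝ] ℝ :=
  -integralCLM (fun x => g x * u x)
    - ∑ i, integralCLM (fun x => σ x i * u x) ∘L partialCLM i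

theorem integrable_mul_partialDeriv {f : Euc N → ℝ} (hf : LocallyIntegrable f volume) (i : Fin N)
    (φ : Test N) : Integrable (fun x => f x * partialDeriv i φ x) volume := by
  have h := (partialCLM i φ).integrable_mul hf
  rwa [coe_partialCLM] at h

theorem dotGrad_mul (σ : Euc N → Euc N) (u φ : Euc N → ℝ) (x : Euc N) :
    dotGrad σ φ x * u x = ∑ i, σ x i * u x * partialDeriv i φ x := by
  rw [dotGrad, Finset.sum_mul]
  exact Finset.sum_congr rfl fun i _ => by ring

theorem integrable_dotGrad_mul {σ : Euc N → Euc N} {u : Euc N → ℝ}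
    (h : ∀ i, LocallyIntegrable (fun x => σ x i * u x) volume) (φ : Test N) :
    Integrable (fun x => dotGrad σ φ x * u x) volume := by
  simp only [dotGrad_mul]
  exact integrable_finsetSum _ fun i _ => integrable_mul_partialDeriv (h i) i φ

theorem integral_dotGrad_mul {σ : Euc N → Euc N} {u : Euc N → ℝ}
    (h : ∀ i, LocallyIntegrable (fun x => σ x i * u x) volume) (φ : Test N) :
    ∫ x, dotGrad σ φ x * u x = ∑ i, ∫ x, σ x i * u x * partialDeriv i φ x := by
  simp only [dotGrad_mul]
  exact integral_finsetSum _ fun i _ => integrable_mul_partialDeriv (h i) i φ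

theorem transportCLM_apply {σ : Euc N → Euc N} {g u : Euc N → ℝ}
    (hg : LocallyIntegrable (fun x => g x * u x) volume)
    (h : ∀ i, LocallyIntegrable (fun x => σ x i * u x) volume) (φ : Test N) :
    transportCLM σ g u φ = -(∫ x, g x * (u x * φ x)) - ∫ x, dotGrad σ φ x * u x := by
  have h1 : transportCLM σ g u φ = -integralCLM (fun x => g x * u x) φ
      - ∑ i, integralCLM (fun x => σ x i * u x) (partialCLM i φ) := by
    simp [transportCLM]
  rw [h1, integralCLM_apply hg, integral_dotGrad_mul h]
  congr 1
  · simp only [mul_assoc]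
  · refine Finset.sum_congr rfl fun i _ => ?_
    rw [integralCLM_apply (h i), coe_partialCLM]

/-- The product rule, integrated against `u`, for the mollification of `σ`. -/
theorem sum_integral_partialDeriv_mulTest {σ : Euc N → Euc N} {g u : Euc N → ℝ}
    (hdiv : IsWeakDiv σ g) (hσ : ∀ i, LocallyIntegrable (fun x => σ x i) volume)
    (hu : LocallyIntegrable u volume) (n : ℕ) (φ : Test N) :
    ∑ i, -∫ x, u x * partialDeriv i (mulTest _ (moll_contDiff (hσ i) n) φ) x =
      -(∫ x, moll n g x * (u x * φ x))
        - ∑ i, ∫ x, moll n (fun y => σ y i) x * (u x * partialDeriv i φ x) := by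
  have h1 : ∀ i, Integrable
      (fun x => moll n (fun y => σ y i) x * (u x * partialDeriv i φ x)) volume := fun i => by
    refine ((mulTest _ (moll_contDiff (hσ i) n) (partialCLM i φ)).integrable_mul hu).congr
      (.of_forall fun x => ?_)
    simp only [mulTest_apply, partialCLM_apply]
    ring
  have h2 : ∀ i, Integrable
      (fun x => partialDeriv i (moll n (fun y => σ y i)) x * (u x * φ x)) volume := fun i => by
    refine ((mulTest _ (contDiff_partialDeriv (moll_contDiff (hσ i) n) i) φ).integrable_mul
      hu).congr (.of_forall fun x => ?_)
    simp only [mulTest_apply]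
    ring
  have h3 : ∀ i, ∫ x, u x * partialDeriv i (mulTest _ (moll_contDiff (hσ i) n) φ) x =
      (∫ x, moll n (fun y => σ y i) x * (u x * partialDeriv i φ x))
        + ∫ x, partialDeriv i (moll n (fun y => σ y i)) x * (u x * φ x) := fun i => by
    rw [← integral_add (h1 i) (h2 i)]
    refine integral_congr_ae (.of_forall fun x => ?_)
    simp only [partialDeriv_mulTest]
    ring
  have h4 : ∫ x, moll n g x * (u x * φ x) =
      ∑ i, ∫ x, partialDeriv i (moll n (fun y => σ y i)) x * (u x * φ x) := by
    rw [← integral_finsetSum _ fun i _ => h2 i]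
    refine integral_congr_ae (.of_forall fun x => ?_)
    simp only
    rw [← div_moll hdiv hσ, Finset.sum_mul]
  simp only [h3, Finset.sum_neg_distrib, Finset.sum_add_distrib, ← h4]
  ring

/-- After the product rule every mollified factor is paired with `u φ` or `u ∂ᵢφ`, a compactly
supported function in `L^p`, so the weak convergence of mollifications applies term by term. -/
theorem tendsto_sum_integral_mulTest {σ : Euc N → Euc N} {g u : Euc N → ℝ} {p q : ℝ≥0∞}
    [p.HolderConjugate q] (hp : p ≠ ∞) (hdiv : IsWeakDiv σ g) (hg : MemLpLoc g q)
    (hσq : ∀ i, MemLpLoc (fun x => σ x i) q) (hu : MemLpLoc u p)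
    (hσ : ∀ i, LocallyIntegrable (fun x => σ x i) volume) (φ : Test N) :
    Tendsto (fun n => ∑ i, -∫ x, u x * partialDeriv i (mulTest _ (moll_contDiff (hσ i) n) φ) x)
      atTop (𝓝 (transportCLM σ g u φ)) := by
  have hul := hu.locallyIntegrable (ENNReal.HolderConjugate.one_le p q)
  rw [transportCLM_apply (hg.mul_locallyIntegrable hu (p := q) (q := p))
    (fun i => (hσq i).mul_locallyIntegrable hu (p := q) (q := p)), integral_dotGrad_mul
    (fun i => (hσq i).mul_locallyIntegrable hu (p := q) (q := p))]
  simp only [sum_integral_partialDeriv_mulTest hdiv hσ hul]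
  refine Tendsto.sub (Tendsto.neg ?_) (tendsto_finsetSum _ fun i _ => ?_)
  · exact tendsto_integral_moll_mul hp (hu.mul_cc φ.continuous φ.hasCompactSupport)
      φ.hasCompactSupport.mul_left hg
  · simp only [mul_assoc]
    have hc : HasCompactSupport (partialDeriv i φ) := by
      rw [← coe_partialCLM]
      exact (partialCLM i φ).hasCompactSupport
    have hcont : Continuous (partialDeriv i φ) := by
      rw [← coe_partialCLM]
      exact (partialCLM i φ).continuous
    exact tendsto_integral_moll_mul hp (hu.mul_cc hcont hc) hc.mul_left (hσq i)

theorem sum_fin_split {N₁ : ℕ} (h : N₁ ≤ N) (f : Fin N → ℝ) :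
    ∑ i, f i = ∑ j : Fin N₁, f (Fin.castLE h j)
      + ∑ i ∈ Finset.univ.filter (fun i : Fin N => N₁ ≤ (i : ℕ)), f i := by
  rw [← Finset.sum_filter_add_sum_filter_not Finset.univ (fun i : Fin N => (i : ℕ) < N₁)]
  simp only [not_lt]
  congr 1
  symm
  refine Finset.sum_bij (fun j _ => Fin.castLE h j) (by simp) (by simp) (fun i hi => ?_) (by simp)
  simp only [Finset.mem_filter, Finset.mem_univ, true_and] at hi
  exact ⟨⟨i, hi⟩, by simp⟩

/-! ### The part of `σ · ∇u` in the first `N₁` directions. -/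

variable {N₁ : ℕ} (hN : N₁ ≤ N)

/-- The linear form `σ · ∇u - ∑_{i > N₁} σ_i ∂_i u` on test functions. -/
def firstPartCLM (N₁ : ℕ) (σ : Euc N → Euc N) (g u : Euc N → ℝ) (d : Fin N → Euc N → ℝ) :
    Test N →L[ℝ] ℝ :=
  transportCLM σ g u
    - ∑ i ∈ Finset.univ.filter (fun i : Fin N => N₁ ≤ (i : ℕ)), integralCLM fun x => σ x i * d i x

theorem firstPartCLM_apply {σ : Euc N → Euc N} {g u : Euc N → ℝ} {d : Fin N → Euc N → ℝ}
    (h : ∀ i : Fin N, N₁ ≤ (i : ℕ) → LocallyIntegrable (fun x => σ x i * d i x) volume)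
    (φ : Test N) :
    firstPartCLM N₁ σ g u d φ = transportCLM σ g u φ -
      ∑ i ∈ Finset.univ.filter (fun i : Fin N => N₁ ≤ (i : ℕ)), ∫ x, σ x i * d i x * φ x := by
  have h1 : firstPartCLM N₁ σ g u d φ = transportCLM σ g u φ -
      ∑ i ∈ Finset.univ.filter (fun i : Fin N => N₁ ≤ (i : ℕ)),
        integralCLM (fun x => σ x i * d i x) φ := by
    simp [firstPartCLM]
  rw [h1]
  congr 1
  refine Finset.sum_congr rfl fun i hi => ?_
  rw [integralCLM_apply (h i (by simpa using hi))]

/-- For `i > N₁` the mollified `σᵢ` is paired with `∂ᵢu φ` in its own pair of dual exponents.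
Subtracting these limits leaves the measure derivatives tested on smooth multiples of `φ`, so no
product of the merely bounded `σ¹` with a measure is formed. -/
theorem tendsto_firstPart {σ : Euc N → Euc N} {g u : Euc N → ℝ} {p q : ℝ≥0∞}
    [p.HolderConjugate q] (hp : p ≠ ∞) (hdiv : IsWeakDiv σ g) (hg : MemLpLoc g q)
    (hσq : ∀ i, MemLpLoc (fun x => σ x i) q) (hu : MemLpLoc u p)
    (hσ : ∀ i, LocallyIntegrable (fun x => σ x i) volume)
    {D : Fin N₁ → RadonMeasure (Euc N)} (hD : ∀ j, IsRadonPartial (Fin.castLE hN j) u (D j))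
    {d : Fin N → Euc N → ℝ} {P Q : Fin N → ℝ≥0∞} (hP : ∀ i, P i ≠ ∞)
    (hPQ : ∀ i, (P i).HolderConjugate (Q i))
    (hd : ∀ i : Fin N, N₁ ≤ (i : ℕ) → MemLpLoc (d i) (P i) ∧ IsWeakPartial i u (d i))
    (hσQ : ∀ i : Fin N, N₁ ≤ (i : ℕ) → MemLpLoc (fun x => σ x i) (Q i)) (φ : Test N) :
    Tendsto (fun n => ∑ j, (D j).toLin
        (mulTest _ (moll_contDiff (hσ (Fin.castLE hN j)) n) φ).toCc)
      atTop (𝓝 (firstPartCLM N₁ σ g u d φ)) := by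
  have h1 := tendsto_sum_integral_mulTest hp hdiv hg hσq hu hσ φ
  have hlim : ∀ i : Fin N, N₁ ≤ (i : ℕ) →
      Tendsto (fun n => -∫ x, u x * partialDeriv i (mulTest _ (moll_contDiff (hσ i) n) φ) x)
        atTop (𝓝 (∫ x, σ x i * d i x * φ x)) := by
    intro i hi
    have := hPQ i
    have h2 := tendsto_integral_moll_mul (hP i)
      ((hd i hi).1.mul_cc φ.continuous φ.hasCompactSupport)
      φ.hasCompactSupport.mul_left (hσQ i hi)
    simp only [mul_assoc]
    refine h2.congr fun n => ?_
    rw [← (hd i hi).2 (mulTest _ (moll_contDiff (hσ i) n) φ)]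
    refine integral_congr_ae (.of_forall fun x => ?_)
    simp only [mulTest_apply]
    ring
  rw [firstPartCLM_apply fun i hi =>
    have := hPQ i
    (hσQ i hi).mul_locallyIntegrable (p := Q i) (q := P i) (hd i hi).1]
  refine (h1.sub (tendsto_finsetSum _ fun i hi => hlim i (by simpa using hi))).congr fun n => ?_
  rw [sum_fin_split hN, add_sub_cancel_right]
  exact Finset.sum_congr rfl fun j _ => (hD j _).symm

/-- For large `n`, the mollification balls centred on `tsupport φ` stay in `U`, so the mollified
`σ¹` has norm at most `M` there. Its components times `φ` then compete in the supremum defining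
`⟨|D|, M |φ|⟩`, and the bound passes to the limit. -/
theorem abs_firstPart_le {σ : Euc N → Euc N} {g u : Euc N → ℝ} {p q : ℝ≥0∞}
    [p.HolderConjugate q] (hp : p ≠ ∞) (hdiv : IsWeakDiv σ g) (hg : MemLpLoc g q)
    (hσq : ∀ i, MemLpLoc (fun x => σ x i) q) (hu : MemLpLoc u p)
    (hσ₁ : LocallyIntegrable (firstProj hN σ) volume)
    {D : Fin N₁ → RadonMeasure (Euc N)} (hD : ∀ j, IsRadonPartial (Fin.castLE hN j) u (D j))
    {d : Fin N → Euc N → ℝ} {P Q : Fin N → ℝ≥0∞} (hP : ∀ i, P i ≠ ∞)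
    (hPQ : ∀ i, (P i).HolderConjugate (Q i))
    (hd : ∀ i : Fin N, N₁ ≤ (i : ℕ) → MemLpLoc (d i) (P i) ∧ IsWeakPartial i u (d i))
    (hσQ : ∀ i : Fin N, N₁ ≤ (i : ℕ) → MemLpLoc (fun x => σ x i) (Q i)) (φ : Test N)
    {U : Set (Euc N)} (hU : IsOpen U) (hφU : tsupport φ ⊆ U) {M : ℝ≥0}
    (hM : ∀ᵐ y ∂volume, y ∈ U → ‖firstProj hN σ y‖ ≤ M) :
    |firstPartCLM N₁ σ g u d φ| ≤ M * tvSup D (absCc φ.toCc) := by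
  have hσ : ∀ i, LocallyIntegrable (fun x => σ x i) volume := fun i =>
    (hσq i).locallyIntegrable (ENNReal.HolderConjugate.one_le q p)
  have h1 := tendsto_firstPart hN hp hdiv hg hσq hu hσ hD hP hPQ hd hσQ φ
  refine le_of_tendsto h1.abs ?_
  obtain ⟨δ, hδ, hδU⟩ := φ.hasCompactSupport.isCompact.exists_thickening_subset_open hU hφU
  have h2 : ∀ᶠ n : ℕ in atTop, 1 / ((n : ℝ) + 1) < δ :=
    tendsto_one_div_add_atTop_nhds_zero_nat.eventually (gt_mem_nhds hδ)
  filter_upwards [h2] with n hn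
  rw [← tvSup_smul]
  refine abs_sum_le_tvSup D _ _ fun x => ?_
  have e : ((M • absCc φ.toCc) x : ℝ) = M * |φ x| := by simp
  rw [e]
  have e2 : ∀ j, (mulTest _ (moll_contDiff (hσ (Fin.castLE hN j)) n) φ).toCc x ^ 2
      = (moll n (firstProj hN σ) x j) ^ 2 * φ x ^ 2 := fun j => by
    rw [Test.toCc_apply, mulTest_apply, moll_proj hσ₁, mul_pow]
    rfl
  simp only [e2, ← Finset.sum_mul, mul_pow, sq_abs]
  by_cases hx : x ∈ tsupport φ
  · refine mul_le_mul_of_nonneg_right ?_ (sq_nonneg _)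
    have h3 := norm_moll_le hM n (x := x) ((Metric.ball_subset_ball hn.le).trans
      ((Metric.ball_subset_thickening hx δ).trans hδU))
    have h4 := EuclideanSpace.real_norm_sq_eq (moll n (firstProj hN σ) x)
    rw [← h4]
    gcongr
  · simp [image_eq_zero_of_notMem_tsupport hx]

/-- The estimate serves twice. Taking a ball around `K` for `U` gives local boundedness, hence a
Radon measure. Taking the open set `φ ≠ 0` for `U`, with test approximations supported in it, then
gives the bound with `M` controlling `τ` on `tsupport φ` only. -/
theorem exists_firstPart_radonMeasure {L : Test N →L[ℝ] ℝ} {τ : Euc N → Euc N₁}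
    (hτ : MemLpLoc τ ∞) {D : Fin N₁ → RadonMeasure (Euc N)}
    (h : ∀ (φ : Test N) (U : Set (Euc N)), IsOpen U → tsupport φ ⊆ U → ∀ M : ℝ≥0,
      (∀ᵐ y ∂volume, y ∈ U → ‖τ y‖ ≤ M) → |L φ| ≤ M * tvSup D (absCc φ.toCc)) :
    ∃ S : RadonMeasure (Euc N), (∀ φ : Test N, S.toLin φ.toCc = L φ) ∧
      ∀ (φ : C_c(Euc N, ℝ)) (M : ℝ≥0),
        (∀ᵐ y ∂volume, y ∈ tsupport φ → ‖τ y‖ ≤ M) → |S.toLin φ| ≤ M * tvSup D (absCc φ) := by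
  have hb : LocallyBounded L.toLinearMap := by
    intro K hK
    obtain ⟨R, hKR⟩ := hK.isBounded.subset_ball 0
    obtain ⟨χ, hχ⟩ := exists_test_one hK
    have hR := (hτ _ (isCompact_closedBall (0 : Euc N) R))
    set M := (eLpNorm τ ∞ (volume.restrict (Metric.closedBall (0 : Euc N) R))).toNNReal
    refine ⟨M * tvSup D (absCc χ.toCc), fun φ hφ hφ1 => ?_⟩
    refine (h φ _ Metric.isOpen_ball (hφ.trans hKR) M ?_).trans ?_
    · have h1 := ae_le_eLpNormEssSup (f := τ)
        (μ := volume.restrict (Metric.closedBall (0 : Euc N) R))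
      rw [ae_restrict_iff' measurableSet_closedBall] at h1
      filter_upwards [h1] with y hy hyR
      have h2 := hy (Metric.ball_subset_closedBall hyR)
      rw [← eLpNorm_exponent_top, ← ENNReal.coe_toNNReal hR.2.ne] at h2
      exact_mod_cast h2
    · refine mul_le_mul_of_nonneg_left (tvSup_mono D fun x => ?_) M.coe_nonneg
      rw [← NNReal.coe_le_coe, absCc_apply, absCc_apply, Test.toCc_apply, Test.toCc_apply]
      by_cases hx : x ∈ K
      · rw [hχ x hx, abs_one]
        exact hφ1 x
      · rw [image_eq_zero_of_notMem_tsupport fun h => hx (hφ h), abs_zero]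
        exact abs_nonneg _
  obtain ⟨S, hS⟩ := hb.exists_radonMeasure
  refine ⟨S, hS, fun φ M hM => abs_le_tvSup_of_test S D M φ fun ψ hψ => ?_⟩
  rw [hS]
  refine h ψ _ (map_continuous φ).isOpen_support hψ M ?_
  filter_upwards [hM] with y hy hyφ using hy (subset_tsupport _ hyφ)

end

/-! ### Anisotropic cut-off functions -/

section

variable {N : ℕ}

/-- The diagonal scaling `x ↦ (a i * x i)`. -/
def scaling (a : Fin N → ℝ) (ha : ∀ i, a i ≠ 0) : Euc N ≃L[ℝ] Euc N :=
  LinearEquiv.toContinuousLinearEquiv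
    { toFun := fun x => WithLp.toLp 2 fun i => a i * x i
      invFun := fun x => WithLp.toLp 2 fun i => (a i)⁻¹ * x i
      map_add' := fun x y => by ext i; simp [mul_add]
      map_smul' := fun c x => by ext i; simp [mul_left_comm]
      left_inv := fun x => by ext i; simp [ha i]
      right_inv := fun x => by ext i; simp [ha i] }

theorem scaling_apply (a : Fin N → ℝ) (ha : ∀ i, a i ≠ 0) (x : Euc N) (i : Fin N) :
    scaling a ha x i = a i * x i := rfl

theorem scaling_single (a : Fin N → ℝ) (ha : ∀ i, a i ≠ 0) (i : Fin N) :
    scaling a ha (EuclideanSpace.single i 1) = a i • EuclideanSpace.single i 1 := by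
  ext j
  by_cases h : j = i
  · subst h; simp [scaling_apply]
  · simp [scaling_apply, h]

variable (N) in
/-- A bump function equal to `1` on the unit ball and supported in the ball of radius `2`. -/
def unitBump : ContDiffBump (0 : Euc N) := ⟨1, 2, one_pos, one_lt_two⟩

/-- The bump function composed with a diagonal scaling. -/
def scaledBump (a : Fin N → ℝ) (ha : ∀ i, a i ≠ 0) : Test N :=
  mkTest (fun x => unitBump N (scaling a ha x))
    ((unitBump N).contDiff.comp (scaling a ha).contDiff)
    ((unitBump N).hasCompactSupport.comp_homeomorph (scaling a ha).toHomeomorph)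

theorem scaledBump_apply (a : Fin N → ℝ) (ha : ∀ i, a i ≠ 0) (x : Euc N) :
    scaledBump a ha x = unitBump N (scaling a ha x) := rfl

theorem partialDeriv_scaledBump (a : Fin N → ℝ) (ha : ∀ i, a i ≠ 0) (i : Fin N) (x : Euc N) :
    partialDeriv i (scaledBump a ha) x = a i * partialDeriv i (unitBump N) (scaling a ha x) := by
  have h1 : HasFDerivAt (unitBump N) (fderiv ℝ (unitBump N) (scaling a ha x))
      (scaling a ha x) :=
    ((unitBump N).contDiff (n := 1).differentiable (by simp) _).hasFDerivAt
  have h2 := h1.comp x (scaling a ha).hasFDerivAt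
  change fderiv ℝ (unitBump N ∘ scaling a ha) x _ = _
  rw [h2.fderiv]
  simp [scaling_single, partialDeriv]

theorem partialDeriv_unitBump_eq_zero (i : Fin N) {y : Euc N} (hy : ‖y‖ < 1) :
    partialDeriv i (unitBump N) y = 0 := by
  have h : unitBump N =ᶠ[𝓝 y] fun _ => (1 : ℝ) :=
    (unitBump N).eventuallyEq_one_of_mem_ball (by simpa [unitBump] using hy)
  rw [partialDeriv, h.fderiv_eq]
  simp

theorem exists_bound_partialDeriv_unitBump (i : Fin N) :
    ∃ C : ℝ, 0 ≤ C ∧ ∀ y, |partialDeriv i (unitBump N) y| ≤ C := by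
  have hcd : ContDiff ℝ ((⊤ : ℕ∞) : WithTop ℕ∞) (unitBump N) := (unitBump N).contDiff
  obtain ⟨C, hC⟩ := (contDiff_partialDeriv hcd i).continuous.bounded_above_of_compact_support
    ((unitBump N).hasCompactSupport.fderiv_apply ℝ _)
  exact ⟨C, (norm_nonneg _).trans (hC 0), hC⟩

/-- The box `{x | ∀ i, |x i| ≤ b i}`. -/
def box (b : Fin N → ℝ) : Set (Euc N) := {x | ∀ i, |x i| ≤ b i}

theorem volume_box (b : Fin N → ℝ) : volume (box b) = ∏ i, ENNReal.ofReal (2 * b i) := by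
  have h := (PiLp.volume_preserving_ofLp (Fin N)).measure_preimage
    (s := Icc (fun i => -b i) b) measurableSet_Icc.nullMeasurableSet
  rw [Real.volume_Icc_pi] at h
  have e : box b = WithLp.ofLp ⁻¹' Icc (fun i => -b i) b := by
    ext x
    simp [box, abs_le, Pi.le_def, forall_and]
  rw [e, h]
  refine Finset.prod_congr rfl fun i _ => ?_
  ring_nf

theorem support_partialDeriv_scaledBump (a : Fin N → ℝ) (ha : ∀ i, 0 < a i) (i : Fin N) :
    Function.support (partialDeriv i (scaledBump a fun i => (ha i).ne')) ⊆
      box (fun i => 2 / a i) := by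
  intro x hx j
  have h1 : scaling a (fun i => (ha i).ne') x ∈ tsupport (unitBump N) := by
    by_contra h
    apply hx
    rw [partialDeriv_scaledBump,
      image_eq_zero_of_notMem_tsupport fun h' => h (tsupport_partialDeriv i _ h'), mul_zero]
  rw [(unitBump N).tsupport_eq, mem_closedBall_zero_iff] at h1
  have h2 := (PiLp.norm_apply_le _ j).trans h1
  rw [scaling_apply, norm_mul, Real.norm_eq_abs, Real.norm_eq_abs, abs_of_pos (ha j)] at h2
  rw [le_div_iff₀ (ha j), mul_comm]
  exact h2

theorem tendsto_eLpNorm_indicator_zero {X : Type*} [MeasurableSpace X] {μ : Measure X} {P : ℝ}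
    (hP : 0 < P) {u : X → ℝ} (hu : MemLp u (ENNReal.ofReal P) μ) {E : ℕ → Set X}
    (hE : ∀ n, MeasurableSet (E n)) (hlim : ∀ x, ∀ᶠ n in atTop, x ∉ E n) :
    Tendsto (fun n => eLpNorm ((E n).indicator u) (ENNReal.ofReal P) μ) atTop (𝓝 0) := by
  have h0 : ENNReal.ofReal P ≠ 0 := by simpa using hP
  have hfin := hu.2
  simp only [eLpNorm_eq_lintegral_rpow_enorm_toReal h0 ENNReal.ofReal_ne_top,
    ENNReal.toReal_ofReal hP.le] at hfin ⊢
  have hfin' : ∫⁻ x, ‖u x‖ₑ ^ P ∂μ ≠ ∞ := by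
    intro h
    rw [h, ENNReal.top_rpow_of_pos (by positivity)] at hfin
    exact lt_irrefl _ hfin
  have h1 : Tendsto (fun n => ∫⁻ x, ‖(E n).indicator u x‖ₑ ^ P ∂μ) atTop
      (𝓝 (∫⁻ _, 0 ∂μ)) := by
    refine tendsto_lintegral_of_dominated_convergence' (fun x => ‖u x‖ₑ ^ P)
      (fun n => ((hu.1.indicator (hE n)).enorm.pow_const P)) (fun n => .of_forall fun x => ?_)
      hfin' (.of_forall fun x => ?_)
    · refine ENNReal.rpow_le_rpow ?_ hP.le
      by_cases hx : x ∈ E n <;> simp [hx]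
    · refine tendsto_const_nhds.congr' ?_
      filter_upwards [hlim x] with n hn
      simp [hn, hP]
  have h2 := h1.ennrpow_const (1 / P)
  simpa [hP] using h2

/-- The function `∂ᵢφₙ` is of size `R^{-αᵢ}` on a box of volume `4^N R`, so its `L^{1/αᵢ}` norm is
bounded independently of `n`. It vanishes on sets that eventually contain each point, so only the
tail of `u` enters, and this tail tends to `0` in `L^P`. -/
theorem exists_anisotropic_cutoff (p : Fin N → ℝ) {P : ℝ} (hp : ∀ i, 0 < p i)
    (hpP : ∀ i, p i < P) (hP : 0 < P) (hsum : ∑ i, (1 / p i - 1 / P) = 1) :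
    ∃ φ : ℕ → Test N, (∀ n x, |φ n x| ≤ 1) ∧ (∀ x, Tendsto (fun n => φ n x) atTop (𝓝 1)) ∧
      ∀ (i : Fin N) (Q : ℝ≥0∞) (u f : Euc N → ℝ), (ENNReal.ofReal (p i)).HolderConjugate Q →
        MemLp u (ENNReal.ofReal P) volume → MemLp f Q volume →
        Tendsto (fun n => ∫ x, f x * u x * partialDeriv i (φ n) x) atTop (𝓝 0) := by
  set α : Fin N → ℝ := fun i => 1 / p i - 1 / P with hα
  have hα0 : ∀ i, 0 < α i := fun i => sub_pos.2 (one_div_lt_one_div_of_lt (hp i) (hpP i))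
  let R : ℕ → ℝ := fun n => (n : ℝ) + 1
  have hR : ∀ n, 0 < R n := fun n => by positivity
  let a : ℕ → Fin N → ℝ := fun n i => R n ^ (-α i)
  have ha : ∀ n i, 0 < a n i := fun n i => Real.rpow_pos_of_pos (hR n) _
  have ha0 : ∀ i, Tendsto (fun n => a n i) atTop (𝓝 0) := fun i =>
    (tendsto_rpow_neg_atTop (hα0 i)).comp
      (tendsto_atTop_add_const_right _ _ tendsto_natCast_atTop_atTop)
  let A : ∀ n, Euc N ≃L[ℝ] Euc N := fun n => scaling (a n) fun i => (ha n i).ne'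
  let φ : ℕ → Test N := fun n => scaledBump (a n) fun i => (ha n i).ne'
  have hA : ∀ x, ∀ᶠ n in atTop, ‖A n x‖ < 1 := by
    intro x
    have h1 : Tendsto (fun n => ∑ i, (a n i * x i) ^ 2) atTop (𝓝 (∑ i : Fin N, (0 * x i) ^ 2)) :=
      tendsto_finsetSum _ fun i _ => ((ha0 i).mul_const _).pow 2
    have h2 : ∀ᶠ n in atTop, ∑ i, (a n i * x i) ^ 2 < 1 :=
      h1.eventually (gt_mem_nhds (by simp))
    filter_upwards [h2] with n hn
    have h3 := EuclideanSpace.real_norm_sq_eq (A n x)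
    have h4 : ‖A n x‖ ^ 2 < 1 := h3.trans_lt hn
    exact (sq_lt_one_iff₀ (norm_nonneg _)).1 h4
  refine ⟨φ, fun n x => ?_, fun x => ?_, fun i Q u f hQ hu hf => ?_⟩
  · rw [scaledBump_apply, abs_of_nonneg (unitBump N).nonneg]
    exact (unitBump N).le_one
  · refine tendsto_const_nhds.congr' ?_
    filter_upwards [hA x] with n hn
    exact ((unitBump N).one_of_mem_closedBall
      (by simpa [unitBump] using hn.le : A n x ∈ _)).symm
  · obtain ⟨C, hC0, hC⟩ := exists_bound_partialDeriv_unitBump i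
    -- The bump is constant where `‖A n x‖ < 1`, so `u` can be replaced by its restriction to `E n`
    -- in the integral.
    let E : ℕ → Set (Euc N) := fun n => {x | 1 ≤ ‖A n x‖}
    have hE : ∀ n, MeasurableSet (E n) := fun n =>
      (isClosed_le continuous_const (A n).continuous.norm).measurableSet
    have hu0 := tendsto_eLpNorm_indicator_zero hP hu hE fun x => (hA x).mono fun n hn h =>
      not_le_of_gt hn h
    have hbound : ∀ n, eLpNorm (partialDeriv i (φ n)) (ENNReal.ofReal (1 / α i)) volume ≤
        ENNReal.ofReal (C * ((4 : ℝ) ^ N) ^ α i) := by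
      intro n
      have hsupp := support_partialDeriv_scaledBump (a n) (ha n) i
      rw [← eLpNorm_restrict_eq_of_support_subset hsupp]
      refine (eLpNorm_le_of_ae_bound (C := C * a n i) (.of_forall fun x => ?_)).trans ?_
      · rw [partialDeriv_scaledBump, norm_mul, Real.norm_of_nonneg (ha n i).le, mul_comm]
        exact mul_le_mul_of_nonneg_right (hC _) (ha n i).le
      · rw [Measure.restrict_apply_univ, volume_box, ← ENNReal.ofReal_prod_of_nonneg
          fun j _ => by have := ha n j; positivity]
        -- The side lengths multiply to `4^N R^{∑ αⱼ}`, and `∑ αⱼ = 1`.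
        have e1 : ∏ j, 2 * (2 / a n j) = 4 ^ N * R n := by
          have e2 : ∀ j, 2 * (2 / a n j) = 4 * R n ^ α j := fun j => by
            simp only [a]
            rw [Real.rpow_neg (hR n).le, div_inv_eq_mul]
            ring
          simp only [e2]
          rw [Finset.prod_mul_distrib, ← Real.rpow_sum_of_pos (hR n), hsum, Real.rpow_one]
          simp
        rw [e1, ENNReal.toReal_ofReal (one_div_nonneg.2 (hα0 i).le), one_div, inv_inv,
          ENNReal.ofReal_rpow_of_nonneg (by have := hR n; positivity) (hα0 i).le,
          ← ENNReal.ofReal_mul (by have := hR n; positivity)]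
        refine ENNReal.ofReal_le_ofReal (le_of_eq ?_)
        rw [Real.mul_rpow (by positivity) (hR n).le]
        have e3 : R n ^ α i * a n i = 1 := by
          simp only [a]
          rw [← Real.rpow_add (hR n), add_neg_cancel, Real.rpow_zero]
        calc _ = C * ((4 : ℝ) ^ N) ^ α i * (R n ^ α i * a n i) := by ring
          _ = _ := by rw [e3, mul_one]
    -- This is `1 / pᵢ = 1 / P + αᵢ`: the product of `u` and `∂ᵢφₙ` lies in `L^{pᵢ}`, dual to the
    -- space of `f`.
    have htr : (ENNReal.ofReal P).HolderTriple (ENNReal.ofReal (1 / α i))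
        (ENNReal.ofReal (p i)) := by
      refine Real.HolderTriple.ennrealOfReal ⟨?_, hP, one_div_pos.2 (hα0 i)⟩
      simp only [hα]
      field_simp
      ring
    have hpart : ∀ n, AEStronglyMeasurable (partialDeriv i (φ n)) volume := fun n =>
      (contDiff_partialDeriv (φ n).contDiff i).continuous.aestronglyMeasurable
    have hv : ∀ n, eLpNorm ((E n).indicator u • partialDeriv i (φ n)) (ENNReal.ofReal (p i)) volume
        ≤ eLpNorm ((E n).indicator u) (ENNReal.ofReal P) volume
          * ENNReal.ofReal (C * ((4 : ℝ) ^ N) ^ α i) := fun n =>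
      (eLpNorm_smul_le_mul_eLpNorm (hpart n) (hu.1.indicator (hE n))).trans
        (mul_le_mul_right (hbound n) _)
    have hvm : ∀ n, MemLp ((E n).indicator u • partialDeriv i (φ n)) (ENNReal.ofReal (p i))
        volume := fun n =>
      ⟨(hu.1.indicator (hE n)).smul (hpart n), (hv n).trans_lt
        (ENNReal.mul_lt_top (hu.indicator (hE n)).2 ENNReal.ofReal_lt_top)⟩
    have hlim : Tendsto (fun n => (eLpNorm ((E n).indicator u • partialDeriv i (φ n))
        (ENNReal.ofReal (p i)) volume).toReal * (eLpNorm f Q volume).toReal) atTop (𝓝 0) := by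
      have h1 := ENNReal.Tendsto.mul_const hu0
        (.inr (ENNReal.ofReal_ne_top (r := C * ((4 : ℝ) ^ N) ^ α i)))
      rw [zero_mul] at h1
      have h2 := tendsto_of_tendsto_of_tendsto_of_le_of_le tendsto_const_nhds h1
        (fun _ => zero_le) hv
      have h3 := (ENNReal.tendsto_toReal ENNReal.zero_ne_top).comp h2
      simpa using h3.mul_const (eLpNorm f Q volume).toReal
    refine squeeze_zero_norm (fun n => ?_) hlim
    refine le_trans (le_of_eq ?_) (abs_integral_mul_le (hvm n) hf)
    rw [Real.norm_eq_abs]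
    congr 1
    refine integral_congr_ae (.of_forall fun x => ?_)
    simp only [Pi.smul_apply', smul_eq_mul]
    by_cases hx : x ∈ E n
    · rw [indicator_of_mem hx]
      ring
    · have h1 : partialDeriv i (φ n) x = 0 := by
        rw [partialDeriv_scaledBump, partialDeriv_unitBump_eq_zero i (not_le.1 hx), mul_zero]
      simp [h1]

end

/-! ### Domination of `|σ¹ · ∇₁u|` by `|∇₁u|` -/

instance {X : Type*} [TopologicalSpace X] {ι : Type*} [Fintype ι] [T2Space X]
    [LocallyCompactSpace X] [MeasurableSpace X] [BorelSpace X] (μ : ι → RadonMeasure X) :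
    (totalVariation μ).Regular := NNRealRMK.rieszMeasure_regular _

instance {X : Type*} [TopologicalSpace X] [T2Space X]
    [LocallyCompactSpace X] [MeasurableSpace X] [BorelSpace X] (μ : RadonMeasure X) :
    μ.abs.Regular := NNRealRMK.rieszMeasure_regular _

section

variable {N m : ℕ}

/-- `|⟨S, φ⟩| ≤ M ⟨|D|, |φ|⟩` whenever `M` bounds `‖τ‖` on the support of `φ`. -/
def IsDominated (S : RadonMeasure (Euc N)) (τ : Euc N → Euc m)
    (D : Fin m → RadonMeasure (Euc N)) : Prop :=
  ∀ (φ : C_c(Euc N, ℝ)) (M : ℝ≥0),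
    (∀ᵐ y ∂volume, y ∈ tsupport φ → ‖τ y‖ ≤ M) → |S.toLin φ| ≤ M * tvSup D (absCc φ)

theorem ae_norm_le_toNNReal {τ : Euc N → Euc m} {K : Set (Euc N)} (hK : MeasurableSet K)
    (hτ : MemLp τ ∞ (volume.restrict K)) :
    ∀ᵐ y ∂volume, y ∈ K → ‖τ y‖ ≤ (eLpNorm τ ∞ (volume.restrict K)).toNNReal := by
  have h1 := ae_le_eLpNormEssSup (f := τ) (μ := volume.restrict K)
  rw [ae_restrict_iff' hK] at h1
  filter_upwards [h1] with y hy hyK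
  have h2 := hy hyK
  rw [← eLpNorm_exponent_top, ← ENNReal.coe_toNNReal hτ.2.ne] at h2
  exact_mod_cast h2

variable {S : RadonMeasure (Euc N)} {τ : Euc N → Euc m} {D : Fin m → RadonMeasure (Euc N)}

theorem IsDominated.lintegral_le (h : IsDominated S τ D) {φ : C_c(Euc N, ℝ≥0)} {M : ℝ≥0}
    (hM : ∀ᵐ y ∂volume, y ∈ tsupport φ → ‖τ y‖ ≤ M) :
    ∫⁻ x, φ x ∂S.abs ≤ M * ∫⁻ x, φ x ∂(totalVariation D) := by
  rw [RadonMeasure.abs, lintegral_totalVariation, lintegral_totalVariation,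
    ← ENNReal.ofReal_coe_nnreal, ← ENNReal.ofReal_mul M.coe_nonneg]
  refine ENNReal.ofReal_le_ofReal (tvSup_unit_le S D M φ fun ψ hψ => h ψ M ?_)
  have hs : tsupport ψ ⊆ tsupport φ := closure_mono fun x hx h0 => hx <| by
    have := hψ x
    rw [h0, NNReal.coe_zero] at this
    exact abs_nonpos_iff.1 this
  filter_upwards [hM] with y hy hyψ using hy (hs hyψ)

theorem IsDominated.lintegral_le_eLpNorm (h : IsDominated S τ D) (hτ : MemLpLoc τ ∞)
    (φ : C_c(Euc N, ℝ≥0)) :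
    ∫⁻ x, φ x ∂S.abs ≤ eLpNorm τ ∞ (volume.restrict (tsupport φ)) *
      ∫⁻ x, φ x ∂(totalVariation D) := by
  have h1 := hτ _ φ.hasCompactSupport.isCompact
  rw [← ENNReal.coe_toNNReal h1.2.ne]
  exact h.lintegral_le (ae_norm_le_toNNReal (isClosed_tsupport φ).measurableSet h1)

/-- As `τ` is only locally bounded, the measures are compared on each ball with its own constant;
countably many balls suffice. -/
theorem IsDominated.absolutelyContinuous (h : IsDominated S τ D) (hτ : MemLpLoc τ ∞) :
    S.abs ≪ totalVariation D := by
  refine Measure.AbsolutelyContinuous.mk fun A hA hA0 => ?_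
  have hcov : A ⊆ ⋃ n : ℕ, A ∩ Metric.ball 0 n := fun x hx => by
    obtain ⟨n, hn⟩ := exists_nat_gt ‖x‖
    exact mem_iUnion.2 ⟨n, hx, by simpa using hn⟩
  refine measure_mono_null hcov (measure_iUnion_null fun n => ?_)
  have h1 := ae_norm_le_toNNReal measurableSet_closedBall
    (hτ _ (isCompact_closedBall (0 : Euc N) n))
  have h2 := measure_le_of_lintegral_le (μ := S.abs) (ν := totalVariation D)
    (Metric.isOpen_ball (x := (0 : Euc N)) (ε := n))
    (fun φ hφ => h.lintegral_le (φ := φ) (by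
      filter_upwards [h1] with y hy hyφ using hy (Metric.ball_subset_closedBall (hφ hyφ))))
    (hA.inter measurableSet_ball) inter_subset_right
  rw [measure_mono_null inter_subset_left hA0, mul_zero] at h2
  exact nonpos_iff_eq_zero.1 h2

theorem IsDominated.abs_le_smul (h : IsDominated S τ D) (hτ : MemLp τ ∞ volume) :
    S.abs ≤ eLpNorm τ ∞ volume • totalVariation D := by
  have h1 := ae_norm_le_toNNReal (K := univ) MeasurableSet.univ (by simpa using hτ)
  simp only [Measure.restrict_univ, mem_univ, forall_const] at h1
  refine Measure.le_intro fun A hA _ => ?_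
  rw [Measure.smul_apply, smul_eq_mul, ← ENNReal.coe_toNNReal hτ.2.ne]
  exact measure_le_of_lintegral_le isOpen_univ
    (fun φ _ => h.lintegral_le (φ := φ) (h1.mono fun y hy _ => hy)) hA (subset_univ _)

/-- Every competitor in the supremum for `|D|` has components bounded by `|φ| ≤ 1`, so the supremum
is at most the sum of the total masses of the components of `D`. -/
theorem IsDominated.exists_bound (h : IsDominated S τ D) (hτ : MemLp τ ∞ volume)
    (hD : ∀ j, ∃ s : SignedMeasure (Euc N), (D j).IsBoundedMeasure s) :
    ∃ C : ℝ, ∀ φ : C_c(Euc N, ℝ), (∀ x, |φ x| ≤ 1) → |S.toLin φ| ≤ C := by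
  choose s hs using hD
  have h1 := ae_norm_le_toNNReal (K := univ) MeasurableSet.univ (by simpa using hτ)
  simp only [Measure.restrict_univ, mem_univ, forall_const] at h1
  refine ⟨_, fun φ hφ => (h φ _ (h1.mono fun y hy _ => hy)).trans
    (mul_le_mul_of_nonneg_left (csSup_le ⟨0, zero_mem_tvSet D _⟩ (a :=
      ∑ j, 1 * (s j).totalVariation.real univ) ?_) (NNReal.coe_nonneg _))⟩
  rintro r ⟨ψ, hψ, rfl⟩
  refine Finset.sum_le_sum fun j _ => ?_
  rw [hs j]
  refine (le_abs_self _).trans (abs_signedIntegral_le _ fun x => ?_)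
  refine le_trans (abs_le_of_sq_le_sq ?_ (absCc φ x).coe_nonneg) ((absCc_apply φ x).le.trans (hφ x))
  exact (Finset.single_le_sum (f := fun j => ψ j x ^ 2) (fun _ _ => sq_nonneg _)
    (Finset.mem_univ j)).trans (hψ x)

theorem RadonMeasure.addDensity_bound {S : RadonMeasure (Euc N)} {g : Euc N → ℝ}
    (hg : LocallyIntegrable g volume) (hgi : Integrable g volume) {C : ℝ}
    (hC : ∀ φ : C_c(Euc N, ℝ), (∀ x, |φ x| ≤ 1) → |S.toLin φ| ≤ C) (φ : C_c(Euc N, ℝ))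
    (hφ : ∀ x, |φ x| ≤ 1) : |(S.addDensity g hg).toLin φ| ≤ C + ∫ x, ‖g x‖ := by
  rw [RadonMeasure.addDensity_apply]
  refine (abs_add_le _ _).trans (add_le_add (hC φ hφ) ?_)
  rw [← Real.norm_eq_abs]
  refine norm_integral_le_of_norm_le hgi.norm (.of_forall fun x => ?_)
  rw [norm_mul]
  exact mul_le_of_le_one_right (norm_nonneg _) (hφ x)

/-! ### Exponents -/

theorem conj_holderConjugate {q : ℝ} (hq : 1 < q) : (ENNReal.ofReal q).HolderConjugate (conj q) :=
  (Real.HolderConjugate.conjExponent hq).ennrealOfReal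

/-- Used to place `σᵢ`, `i > N₁`, locally in the dual of `L^{p*}`, since `pᵢ < p*`. -/
theorem conj_antitone {q r : ℝ} (hq : 1 < q) (hqr : q ≤ r) : conj r ≤ conj q := by
  refine ENNReal.ofReal_le_ofReal ?_
  rw [div_le_div_iff₀ (by linarith) (by linarith)]
  nlinarith

theorem pos_of_invExp_pos {N₁ : ℕ} (hN : N₁ ≤ N) {p : Fin N → ℝ} (h : 0 < invExp N₁ p) :
    0 < N := by
  rcases Nat.eq_zero_or_pos N with rfl | h0
  · obtain rfl : N₁ = 0 := by omega
    simp only [invExp, Finset.univ_eq_empty, Finset.filter_empty, Finset.sum_empty,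
      Nat.cast_zero] at h
    linarith
  · exact h0

/-- The exponents equal to `1` contribute `N₁`, so `∑ 1 / pᵢ = N / p* + 1`. This is the scaling
relation behind the cut-offs. -/
theorem sum_inv_sub_inv_pStar {N₁ : ℕ} (hN : N₁ ≤ N) {p : Fin N → ℝ}
    (hp_one : ∀ i : Fin N, (i : ℕ) < N₁ → p i = 1) (h : 0 < invExp N₁ p) :
    ∑ i, (1 / p i - 1 / pStar N₁ p) = 1 := by
  have hN0 : (N : ℝ) ≠ 0 := by exact_mod_cast (pos_of_invExp_pos hN h).ne'
  have h1 : ∑ i, 1 / p i = invExp N₁ p + 1 := by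
    rw [sum_fin_split hN, invExp]
    have : ∀ j : Fin N₁, 1 / p (Fin.castLE hN j) = 1 := fun j => by
      rw [hp_one _ (by simp), one_div_one]
    simp [this]
  rw [Finset.sum_sub_distrib, h1]
  simp only [pStar, Finset.sum_const, Finset.card_univ, Fintype.card_fin, nsmul_eq_mul]
  have := h.ne'
  field_simp
  ring

theorem memLp_of_firstProj {N₁ : ℕ} (hN : N₁ ≤ N) {σ : Euc N → Euc N} {q : ℝ≥0∞}
    {μ : Measure (Euc N)} (h : MemLp (firstProj hN σ) q μ) {i : Fin N} (hi : (i : ℕ) < N₁) :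
    MemLp (fun x => σ x i) q μ :=
  (EuclideanSpace.proj (𝕜 := ℝ) (ι := Fin N₁) ⟨i, hi⟩).comp_memLp' h

theorem MemBV.exists_isBoundedMeasure {N₁ : ℕ} {p : Fin N → ℝ} {u : Euc N → ℝ}
    (hu : MemBV N₁ p u) {i : Fin N} (hi : (i : ℕ) < N₁) {μ : RadonMeasure (Euc N)}
    (hμ : IsRadonPartial i u μ) : ∃ s : SignedMeasure (Euc N), μ.IsBoundedMeasure s := by
  obtain ⟨s, hs⟩ := hu.partial_measure i hi
  exact ⟨s, isBoundedMeasure_of_test μ s fun φ => (hμ φ).trans (hs φ).symm⟩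

/-- Uniqueness of weak derivatives transfers global integrability to the derivative that was glued
from local ones. -/
theorem MemBV.memLp_of_isWeakPartial {N₁ : ℕ} {p : Fin N → ℝ} {u d : Euc N → ℝ}
    (hu : MemBV N₁ p u) {i : Fin N} (hi : N₁ ≤ (i : ℕ)) (hp : 1 ≤ p i)
    (hdl : LocallyIntegrable d volume) (hd : IsWeakPartial i u d) :
    MemLp d (ENNReal.ofReal (p i)) volume := by
  obtain ⟨d', hd', hdw'⟩ := hu.partial_memLp i hi
  have h := ae_eq_of_isWeakPartial isOpen_univ
    (hd'.locallyIntegrable (by simpa using ENNReal.ofReal_le_ofReal hp)) hdl hdw' hd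
    fun _ _ => rfl
  exact hd'.ae_eq (h.mono fun x hx => hx trivial)

/-- The total mass of a bounded measure extending `σ · ∇u`. -/
theorem signedMeasure_univ_eq {p : Fin N → ℝ} {P : ℝ} (hp : ∀ i, 0 < p i)
    (hpP : ∀ i, p i < P) (hP : 0 < P) (hsum : ∑ i, (1 / p i - 1 / P) = 1)
    {σ : Euc N → Euc N} {g u : Euc N → ℝ} {Q : Fin N → ℝ≥0∞}
    (hQ : ∀ i, (ENNReal.ofReal (p i)).HolderConjugate (Q i))
    (hσ : ∀ i, MemLp (fun x => σ x i) (Q i) volume) (hu : MemLp u (ENNReal.ofReal P) volume)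
    (hg : Integrable (fun x => g x * u x) volume)
    (hσu : ∀ i, LocallyIntegrable (fun x => σ x i * u x) volume) {s : SignedMeasure (Euc N)}
    (hs : ∀ φ : Test N, signedIntegral s φ = transportCLM σ g u φ) :
    s univ = -∫ x, g x * u x := by
  obtain ⟨φ, hφ1, hφlim, hφ⟩ := exists_anisotropic_cutoff p hp hpP hP hsum
  have h1 := tendsto_signedIntegral_univ s (fun n => (φ n).continuous.measurable) hφ1 hφlim
  refine tendsto_nhds_unique h1 ?_
  simp only [hs, transportCLM_apply hg.locallyIntegrable hσu, integral_dotGrad_mul hσu]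
  have h2 : Tendsto (fun n => ∫ x, g x * (u x * φ n x)) atTop (𝓝 (∫ x, g x * u x)) := by
    refine tendsto_integral_of_dominated_convergence (fun x => ‖g x * u x‖) (fun n => ?_) hg.norm
      (fun n => .of_forall fun x => ?_) (.of_forall fun x => ?_)
    · simp only [← mul_assoc]
      exact ((φ n).integrable_mul hg.locallyIntegrable).1
    · rw [← mul_assoc, norm_mul]
      exact mul_le_of_le_one_right (norm_nonneg _) (hφ1 n x)
    · simpa [mul_assoc] using (hφlim x).const_mul (g x * u x)
  -- The flux at infinity vanishes: this is where the anisotropic scaling of the cut-offs is used.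
  have h3 : Tendsto (fun n => ∑ i, ∫ x, σ x i * u x * partialDeriv i (φ n) x) atTop
      (𝓝 (∑ _i : Fin N, 0)) :=
    tendsto_finsetSum _ fun i _ => hφ i (Q i) u _ (hQ i) hu (hσ i)
  simpa using h2.neg.sub h3

end

end

end AnisoBV

/-! ### Local and global statements for `σ · ∇u`. -/

theorem mainTheorem4 (N N₁ : ℕ) (hN : N₁ ≤ N) (p : Fin N → ℝ)
    (hp_one : ∀ i : Fin N, (i : ℕ) < N₁ → p i = 1)
    (hp_gt : ∀ i : Fin N, N₁ ≤ (i : ℕ) → 1 < p i)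
    (hp_pos : 0 < AnisoBV.invExp N₁ p)
    (hp_lt : ∀ i : Fin N, p i < AnisoBV.pStar N₁ p)
    (σ : AnisoBV.Euc N → AnisoBV.Euc N)
    (hσ_first : AnisoBV.MemLpLoc (AnisoBV.firstProj hN σ) ∞)
    (hσ_rest : ∀ i : Fin N, N₁ ≤ (i : ℕ) →
      AnisoBV.MemLpLoc (fun x => σ x i) (AnisoBV.conj (p i)))
    (divσ : AnisoBV.Euc N → ℝ) (hdiv : AnisoBV.IsWeakDiv σ divσ)
    (hdiv_mem : AnisoBV.MemLpLoc divσ (AnisoBV.conj (AnisoBV.pStar N₁ p)))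
    (u : AnisoBV.Euc N → ℝ) (hu : AnisoBV.MemBVLoc N₁ p u) :
    -- the distribution `σ · ∇u`
    ∃ T : 𝓓'((⊤ : Opens (AnisoBV.Euc N)), ℝ),
      (∀ φ : AnisoBV.Test N,
        Integrable (fun x => divσ x * (u x * φ x)) ∧
        Integrable (fun x => AnisoBV.dotGrad σ φ x * u x) ∧
        T φ = -(∫ x, divσ x * (u x * φ x)) - ∫ x, AnisoBV.dotGrad σ φ x * u x) ∧
    -- is a Radon measure `S`
    ∃ S : AnisoBV.RadonMeasure (AnisoBV.Euc N),
      (∀ φ : AnisoBV.Test N, S.toLin φ.toCc = T φ) ∧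
    -- `D = ∇₁u`, and `d i = ∂_i u` for the other indices
    ∃ D : Fin N₁ → AnisoBV.RadonMeasure (AnisoBV.Euc N),
      (∀ j : Fin N₁, AnisoBV.IsRadonPartial (Fin.castLE hN j) u (D j)) ∧
    ∃ d : Fin N → AnisoBV.Euc N → ℝ,
      (∀ i : Fin N, N₁ ≤ (i : ℕ) →
        AnisoBV.MemLpLoc (d i) (ENNReal.ofReal (p i)) ∧ AnisoBV.IsWeakPartial i u (d i) ∧
        LocallyIntegrable (fun x => σ x i * d i x)) ∧
    -- `S₁ = σ¹ · ∇₁u`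
    ∃ S₁ : AnisoBV.RadonMeasure (AnisoBV.Euc N),
      (∀ φ : C_c(AnisoBV.Euc N, ℝ), S₁.toLin φ = S.toLin φ -
        ∑ i ∈ Finset.univ.filter (fun i : Fin N => N₁ ≤ (i : ℕ)), ∫ x, σ x i * d i x * φ x) ∧
      S₁.abs ≪ AnisoBV.totalVariation D ∧
      (∀ φ : C_c(AnisoBV.Euc N, ℝ≥0),
        ∫⁻ x, φ x ∂S₁.abs ≤
          eLpNorm (AnisoBV.firstProj hN σ) ∞ (volume.restrict (tsupport φ)) *
            ∫⁻ x, φ x ∂(AnisoBV.totalVariation D)) ∧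
    -- the global statement
      (MemLp (AnisoBV.firstProj hN σ) ∞ volume →
        (∀ i : Fin N, N₁ ≤ (i : ℕ) → MemLp (fun x => σ x i) (AnisoBV.conj (p i)) volume) →
        MemLp divσ (AnisoBV.conj (AnisoBV.pStar N₁ p)) volume →
        AnisoBV.MemBV N₁ p u →
        ∃ s s₁ : SignedMeasure (AnisoBV.Euc N),
          S.IsBoundedMeasure s ∧ S₁.IsBoundedMeasure s₁ ∧
          Integrable (fun x => divσ x * u x) ∧
          s univ = -∫ x, divσ x * u x ∧
          S₁.abs ≤ eLpNorm (AnisoBV.firstProj hN σ) ∞ volume • AnisoBV.totalVariation D) := by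
  have hN0 := AnisoBV.pos_of_invExp_pos hN hp_pos
  have hp1 : ∀ i, 1 ≤ p i := fun i => by
    rcases lt_or_ge (i : ℕ) N₁ with hi | hi
    · exact (hp_one i hi).ge
    · exact (hp_gt i hi).le
  have hP1 : 1 < AnisoBV.pStar N₁ p := (hp1 ⟨0, hN0⟩).trans_lt (hp_lt _)
  have hPq := AnisoBV.conj_holderConjugate hP1
  let P : Fin N → ℝ≥0∞ := fun i => ENNReal.ofReal (p i)
  -- The value `∞` is set by hand because `conj 1` is `0` by the convention for division by zero.
  let Q : Fin N → ℝ≥0∞ := fun i => if (i : ℕ) < N₁ then ∞ else AnisoBV.conj (p i)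
  have hPQ : ∀ i, (P i).HolderConjugate (Q i) := fun i => by
    rcases lt_or_ge (i : ℕ) N₁ with hi | hi
    · simp only [P, Q, hi, if_true, hp_one i hi, ENNReal.ofReal_one]
      infer_instance
    · simpa only [P, Q, hi.not_gt, if_false] using AnisoBV.conj_holderConjugate (hp_gt i hi)
  have hQ_rest : ∀ i : Fin N, N₁ ≤ (i : ℕ) → Q i = AnisoBV.conj (p i) := fun i hi => by
    simp only [Q, hi.not_gt, if_false]
  have hQ_first : ∀ i : Fin N, (i : ℕ) < N₁ → Q i = ∞ := fun i hi => by
    simp only [Q, hi, if_true]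
  have hσq : ∀ i, AnisoBV.MemLpLoc (fun x => σ x i) (AnisoBV.conj (AnisoBV.pStar N₁ p)) :=
    fun i => by
      rcases lt_or_ge (i : ℕ) N₁ with hi | hi
      · exact AnisoBV.MemLpLoc.mono_exponent le_top fun K hK =>
          AnisoBV.memLp_of_firstProj hN (hσ_first K hK) hi
      · exact (hσ_rest i hi).mono_exponent
          (AnisoBV.conj_antitone (hp_gt i hi) (hp_lt i).le)
  have hσQ : ∀ i : Fin N, N₁ ≤ (i : ℕ) → AnisoBV.MemLpLoc (fun x => σ x i) (Q i) :=
    fun i hi => (hQ_rest i hi).symm ▸ hσ_rest i hi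
  have huP : AnisoBV.MemLpLoc u (ENNReal.ofReal (AnisoBV.pStar N₁ p)) :=
    AnisoBV.memLpLoc_of_test fun χ => (hu χ).memLp
  have hul := huP.locallyIntegrable
    (ENNReal.HolderConjugate.one_le _ (AnisoBV.conj (AnisoBV.pStar N₁ p)))
  have hgu : LocallyIntegrable (fun x => divσ x * u x) volume :=
    have := hPq.symm
    hdiv_mem.mul_locallyIntegrable huP
  have hσu : ∀ i, LocallyIntegrable (fun x => σ x i * u x) volume := fun i =>
    have := hPq.symm
    (hσq i).mul_locallyIntegrable huP
  have hD : ∀ j : Fin N₁, ∃ μ, AnisoBV.IsRadonPartial (Fin.castLE hN j) u μ := fun j =>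
    AnisoBV.exists_isRadonPartial hul _ fun χ => (hu χ).partial_measure _ (by simp)
  choose D hD using hD
  have hd : ∀ i : Fin N, ∃ d : AnisoBV.Euc N → ℝ, N₁ ≤ (i : ℕ) →
      AnisoBV.MemLpLoc d (P i) ∧ AnisoBV.IsWeakPartial i u d := fun i => by
    by_cases hi : N₁ ≤ (i : ℕ)
    · obtain ⟨d, hd⟩ := AnisoBV.exists_isWeakPartial
        (have := hPQ i; ENNReal.HolderConjugate.one_le (P i) (Q i)) i
        fun χ => (hu χ).partial_memLp i hi
      exact ⟨d, fun _ => hd⟩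
    · exact ⟨0, fun h => absurd h hi⟩
  choose d hd using hd
  have hσd : ∀ i : Fin N, N₁ ≤ (i : ℕ) → LocallyIntegrable (fun x => σ x i * d i x) volume :=
    fun i hi =>
      have := (hPQ i).symm
      (hσQ i hi).mul_locallyIntegrable (hd i hi).1
  have hσ₁ := hσ_first.locallyIntegrable le_top
  -- The measure `σ¹ · ∇₁u` is obtained before `σ · ∇u`: the domination makes it Radon, and adding
  -- the locally integrable density below yields the Radon measure `σ · ∇u`.
  obtain ⟨S₁, hS₁, hdom⟩ := AnisoBV.exists_firstPart_radonMeasure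
    (L := AnisoBV.firstPartCLM N₁ σ divσ u d) hσ_first (D := D)
    fun φ U hU hφU M hM => AnisoBV.abs_firstPart_le hN ENNReal.ofReal_ne_top hdiv hdiv_mem hσq huP
      hσ₁ hD (fun _ => ENNReal.ofReal_ne_top) hPQ hd hσQ φ hU hφU hM
  have hdom : AnisoBV.IsDominated S₁ (AnisoBV.firstProj hN σ) D := hdom
  let I := Finset.univ.filter (fun i : Fin N => N₁ ≤ (i : ℕ))
  have hI : ∀ i ∈ I, N₁ ≤ (i : ℕ) := fun i hi => by simpa [I] using hi
  have hh : LocallyIntegrable (fun x => ∑ i ∈ I, σ x i * d i x) volume :=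
    locallyIntegrable_finsetSum _ fun i hi => hσd i (hI i hi)
  have hhφ : ∀ φ : C_c(AnisoBV.Euc N, ℝ), ∫ x, (∑ i ∈ I, σ x i * d i x) * φ x =
      ∑ i ∈ I, ∫ x, σ x i * d i x * φ x := fun φ => by
    simp only [Finset.sum_mul]
    refine integral_finsetSum _ fun i hi => ?_
    simpa [mul_comm] using (hσd i (hI i hi)).integrable_smul_left_of_hasCompactSupport
      (map_continuous φ) φ.hasCompactSupport
  let T := AnisoBV.transportCLM σ divσ u
  have hT : ∀ φ, T φ = _ := AnisoBV.transportCLM_apply hgu hσu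
  have hST : ∀ φ : AnisoBV.Test N, (S₁.addDensity _ hh).toLin φ.toCc = T φ := fun φ => by
    rw [AnisoBV.RadonMeasure.addDensity_apply, hhφ, hS₁, AnisoBV.firstPartCLM_apply hσd]
    exact sub_add_cancel _ _
  refine ⟨⟨T.toLinearMap, T.cont⟩, fun φ => ⟨?_, AnisoBV.integrable_dotGrad_mul hσu φ, hT φ⟩,
    S₁.addDensity _ hh, hST, D, hD, d, fun i hi => ⟨(hd i hi).1, (hd i hi).2, hσd i hi⟩,
    S₁, fun φ => ?_, hdom.absolutelyContinuous hσ_first, hdom.lintegral_le_eLpNorm hσ_first,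
    fun hτ hσg hg hub => ?_⟩
  · simpa only [mul_assoc] using φ.integrable_mul hgu
  · rw [AnisoBV.RadonMeasure.addDensity_apply, hhφ, add_sub_cancel_right]
  · have hgui : Integrable (fun x => divσ x * u x) volume :=
      have := hPq.symm
      hg.integrable_mul hub.memLp
    have hσQg : ∀ i, MemLp (fun x => σ x i) (Q i) volume := fun i => by
      rcases lt_or_ge (i : ℕ) N₁ with hi | hi
      · rw [hQ_first i hi]
        exact AnisoBV.memLp_of_firstProj hN hτ hi
      · rw [hQ_rest i hi]
        exact hσg i hi
    have hhi : Integrable (fun x => ∑ i ∈ I, σ x i * d i x) volume :=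
      integrable_finsetSum _ fun i hi =>
        have := hPQ i
        have := (hPQ i).symm
        (hσQg i).integrable_mul (hub.memLp_of_isWeakPartial (hI i hi) (hp1 i)
          ((hd i (hI i hi)).1.locallyIntegrable (ENNReal.HolderConjugate.one_le (P i) (Q i)))
          (hd i (hI i hi)).2)
    obtain ⟨C, hC⟩ := hdom.exists_bound hτ fun j =>
      hub.exists_isBoundedMeasure (i := Fin.castLE hN j) (by simp) (hD j)
    obtain ⟨s₁, hs₁⟩ := AnisoBV.exists_signedMeasure_of_bounded S₁ hC
    obtain ⟨s, hs⟩ := AnisoBV.exists_signedMeasure_of_bounded _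
      (AnisoBV.RadonMeasure.addDensity_bound hh hhi hC)
    refine ⟨s, s₁, hs, hs₁, hgui, ?_, hdom.abs_le_smul hτ⟩
    exact AnisoBV.signedMeasure_univ_eq (fun i => one_pos.trans_le (hp1 i)) hp_lt
      (one_pos.trans hP1) (AnisoBV.sum_inv_sub_inv_pStar hN hp_one hp_pos) hPQ hσQg hub.memLp
      hgui hσu fun φ => (hs φ.toCc).symm.trans (hST φ)
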